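/- \textbf{Model.} Fix $p_\circ,p_\bullet\in[0,1]$, $v_\circ=2p_\circ-1$, $v_\bullet=2p_\bullet-1$, $q\in(0,1)$ and $\rho\in(0,\infty)$. Let $N(z)$, $z\in\mathbb Z$, be i.i.d.\ Poisson($\rho$). Let $S^{z,i}=(S^{z,i}_n)_{n\in\mathbb Z}$, $z\in\mathbb Z$, $i\ge 1$, be independent two-sided lazy simple random walks on $\mathbb Z$ with $S^{z,i}_0=z$, whose steps are $-1,0,1$ with probabilities $\frac{1-q}2,q,\frac{1-q}2$. Let $U_y$, $y\in\mathbb Z^2$, be i.i.d.\ uniform on $[0,1]$. The three families are independent, and $\mathbb P$ is their joint law. For a set $A$ of trajectories let $\omega(A)=\#\{(z,i):1\le i\le N(z),\ S^{z,i}\in A\}$, and let $\mathcal T=\{(S^{z,i}_n,n): z\in\mathbb Z,\ 1\le i\le N(z),\ n\in\mathbb Z\}$. For $y\in\mathbb Z^2$ let $Y^y_0=y$ and $Y^y_{n+1}=Y^y_n+(1,1)$ if either $Y^y_n\in\mathcal T$ and $U_{Y^y_n}\le p_\bullet$, or $Y^y_n\notin\mathcal T$ and $U_{Y^y_n}\le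 p_\circ$; otherwise $Y^y_{n+1}=Y^y_n+(-1,1)$. Write $Y=Y^{(0,0)}$ and let $X_n$ be the first coordinate of $Y_n$. \textbf{Regeneration time.} For $v_\star\in(0,v_\bullet)$ let $\bar v=v_\star/3$ and \[\angle(y)=y+\{(x,n)\in\mathbb Z^2: x\ge 0,\ n\ge 0,\ x\ge\bar v n\},\qquad \angle^-(y)=y+\{(x,n)\in\mathbb Z^2: x\le 0,\ n\le 0,\ x<\bar v n\}.\] Let $W^{\times}_y$ be the set of nearest-neighbour (lazy steps allowed) trajectories $w:\mathbb Z\to\mathbb Z$ whose trace $\{(w(n),n):n\in\mathbb Z\}$ intersects both $\angle(y)$ and $\angle^-(y)$. Let $A^y=\{Y^y_i\in\angle(y)\ \forall i\ge 0\}$ and $\Gamma(y)=\{\omega(W^\times_y)=0\}\cap A^y$. For $k\ge 1$ let $R_k=\inf\{n\ge 0: X_n\ge(1-\bar v)k+\bar v n\}$. Let $\mathcal I=\inf\{k\ge 1: R_k<\infty \text{ and } \Gamma(Y_{R_k})\text{ occurs}\}$ and $\tau=R_{\mathcal I}$, with $\tau=\infty$ if $\mathcal I=\infty$. Let $\mathbb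 P^\angle=\mathbb P(\,\cdot\mid\Gamma(0,0))$. \textbf{Theorem.} Let $v_\circ>-1$, $v_\star\in(0,v_\bullet)$, and assume that the $v_\star$-ballisticity condition holds with constants $c_0>0$ and $\gamma>1$, i.e. \[\mathbb P\big(\exists\,n\ge 1: X_n<nv_\star-L\big)\le c_0^{-1}e^{-c_0\log^\gamma L}\qquad\text{for all integers }L\ge 1.\] Then $\mathbb P(\Gamma(0,0))>0$, so that $\mathbb P^\angle$ is well defined, and there exists a constant $c>0$ such that \[\mathbb E\big[e^{c\log^\gamma\tau}\big]<\infty\quad\text{and}\quad\mathbb E^\angle\big[e^{c\log^\gamma\tau}\big]<\infty,\] where $\gamma$ is the exponent of the ballisticity condition and $e^{c\log^\gamma\infty}=\infty$. (In particular $\tau<\infty$ almost surely under both laws.) -/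

import Mathlib

open scoped NNReal ENNReal

namespace RWDRE

/-! ### The probability space

A sample consists of
* the initial numbers `N z` of environment particles at the sites `z : ℤ`,
* the increments `ξ (z, i, k)` (the step between times `k` and `k + 1`) of the two-sided
  trajectory of the `i`-th potential particle that is at `z` at time `0`,
* the variables `U y`, `y : ℤ × ℤ`, that are used to move the walk.
A space-time point is a pair `(x, n)` with `x` the space and `n` the time coordinate. -/

/-- The canonical sample space. -/
abbrev Sample : Type :=
  (ℤ → ℕ) × (ℤ × ℕ × ℤ → ℤ) × (ℤ × ℤ → unitInterval)

/-- The law of one step of a lazy simple random walk: `-1`, `0`, `1` with probabilities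
`(1 - q) / 2`, `q`, `(1 - q) / 2`. -/
noncomputable def lazyStep (q : ℝ) : MeasureTheory.Measure ℤ :=
  ENNReal.ofReal ((1 - q) / 2) • MeasureTheory.Measure.dirac (-1) +
    ENNReal.ofReal q • MeasureTheory.Measure.dirac 0 +
    ENNReal.ofReal ((1 - q) / 2) • MeasureTheory.Measure.dirac 1

theorem isProbabilityMeasure_lazyStep {q : ℝ} (h0 : 0 ≤ q) (h1 : q ≤ 1) :
    MeasureTheory.IsProbabilityMeasure (lazyStep q) := by
  constructor
  have h2 : 0 ≤ (1 - q) / 2 := by linarith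
  simp only [lazyStep, MeasureTheory.Measure.coe_add, MeasureTheory.Measure.coe_smul,
    Pi.add_apply, Pi.smul_apply, MeasureTheory.measure_univ, smul_eq_mul, mul_one]
  rw [← ENNReal.ofReal_add h2 h0, ← ENNReal.ofReal_add (by linarith) h2, ← ENNReal.ofReal_one]
  congr 1
  ring

/-- The joint law `ℙ^ρ` of the independent families: i.i.d. Poisson(`ρ`) initial numbers, i.i.d.
lazy steps, and i.i.d. uniform variables on `[0,1]`. -/
noncomputable def law (q : ℝ) (ρ : ℝ≥0) : MeasureTheory.Measure Sample :=
  (MeasureTheory.Measure.infinitePi fun _ : ℤ => ProbabilityTheory.poissonMeasure ρ).prod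
    ((MeasureTheory.Measure.infinitePi fun _ : ℤ × ℕ × ℤ => lazyStep q).prod
      (MeasureTheory.Measure.infinitePi fun _ : ℤ × ℤ =>
        (MeasureTheory.volume : MeasureTheory.Measure unitInterval)))

theorem isProbabilityMeasure_law {q : ℝ} (h0 : 0 ≤ q) (h1 : q ≤ 1) (ρ : ℝ≥0) :
    MeasureTheory.IsProbabilityMeasure (law q ρ) := by
  have := isProbabilityMeasure_lazyStep h0 h1
  unfold law
  infer_instance

/-! ### The environment -/

/-- The two-sided trajectory `S^{z,i}`: it is at `z` at time `0`, and
`S^{z,i}_{n+1} - S^{z,i}_n = ξ (z, i, n)` for every `n : ℤ`. -/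
noncomputable def path (s : Sample) (z : ℤ) (i : ℕ) (n : ℤ) : ℤ :=
  z + ∑ k ∈ Finset.Ico 0 n, s.2.1 (z, i, k) - ∑ k ∈ Finset.Ico n 0, s.2.1 (z, i, k)

/-- `ω(A)`: the number of environment particles whose trajectory lies in `A`. The particles that
start at `z` are those with index `i < N z`. -/
noncomputable def omega (s : Sample) (A : Set (ℤ → ℤ)) : ℕ∞ :=
  Set.encard {p : ℤ × ℕ | p.2 < s.1 p.1 ∧ path s p.1 p.2 ∈ A}

/-- The set `𝒯` of space-time points covered by the trajectory of some environment particle. -/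
def trace (s : Sample) : Set (ℤ × ℤ) :=
  {y | ∃ z : ℤ, ∃ i : ℕ, i < s.1 z ∧ path s z i y.2 = y.1}

/-! ### The random walk -/

open Classical in
/-- The space-time process `Y^y` started at `y`. -/
noncomputable def Y (p₀ p₁ : ℝ) (s : Sample) (y : ℤ × ℤ) : ℕ → ℤ × ℤ
  | 0 => y
  | n + 1 =>
    if (Y p₀ p₁ s y n ∈ trace s ∧ (s.2.2 (Y p₀ p₁ s y n) : ℝ) ≤ p₁) ∨
        (Y p₀ p₁ s y n ∉ trace s ∧ (s.2.2 (Y p₀ p₁ s y n) : ℝ) ≤ p₀)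
    then Y p₀ p₁ s y n + (1, 1)
    else Y p₀ p₁ s y n + (-1, 1)

/-- The random walk `X` started at the origin at time `0`. -/
noncomputable def X (p₀ p₁ : ℝ) (s : Sample) (n : ℕ) : ℤ := (Y p₀ p₁ s (0, 0) n).1

/-- The bound `ℙ^ρ(∃ n ∈ ℕ, X_n < n v⋆ - L) ≤ c⁻¹ exp(-c (log L)^γ)` for all `L ∈ ℕ`, where
`ℕ = {1, 2, …}`: the `v⋆`-ballisticity condition with constants `c` and `γ`. -/
def BallisticityBound (p₀ p₁ q : ℝ) (ρ : ℝ≥0) (vstar c γ : ℝ) : Prop :=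
  ∀ L : ℕ, 1 ≤ L →
    law q ρ {s | ∃ n : ℕ, 1 ≤ n ∧ (X p₀ p₁ s n : ℝ) < n * vstar - L} ≤
      ENNReal.ofReal (c⁻¹ * Real.exp (-c * Real.log L ^ γ))

/-! ### Cones and trajectories; `v` is the slope of the cones -/

/-- The cone `∠(y)` in the first quadrant based at `y`. -/
def cone (v : ℝ) (y : ℤ × ℤ) : Set (ℤ × ℤ) :=
  {z | 0 ≤ z.1 - y.1 ∧ 0 ≤ z.2 - y.2 ∧ v * ((z.2 - y.2 : ℤ) : ℝ) ≤ ((z.1 - y.1 : ℤ) : ℝ)}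

/-- The cone in the third quadrant based at `y`. -/
def backCone (v : ℝ) (y : ℤ × ℤ) : Set (ℤ × ℤ) :=
  {z | z.1 - y.1 ≤ 0 ∧ z.2 - y.2 ≤ 0 ∧ ((z.1 - y.1 : ℤ) : ℝ) < v * ((z.2 - y.2 : ℤ) : ℝ)}

/-- The set `W` of two-sided nearest-neighbour trajectories on `ℤ`. -/
def trajectories : Set (ℤ → ℤ) := {w | ∀ n : ℤ, |w (n + 1) - w n| ≤ 1}

/-- The trajectories in `W` that intersect both the cone and the backward cone based at `y`. -/
def crossing (v : ℝ) (y : ℤ × ℤ) : Set (ℤ → ℤ) :=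
  {w | w ∈ trajectories ∧ (∃ n : ℤ, (w n, n) ∈ cone v y) ∧ ∃ n : ℤ, (w n, n) ∈ backCone v y}

/-- The event `A^y`: the walk started at `y` stays in the cone `∠(y)` forever. -/
def StaysInCone (p₀ p₁ v : ℝ) (s : Sample) (y : ℤ × ℤ) : Prop :=
  ∀ i : ℕ, Y p₀ p₁ s y i ∈ cone v y

/-- The event that no environment particle crosses at `y` and that `A^y` occurs. -/
def Regenerates (p₀ p₁ v : ℝ) (s : Sample) (y : ℤ × ℤ) : Prop :=
  omega s (crossing v y) = 0 ∧ StaysInCone p₀ p₁ v s y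

/-! ### Record times and the regeneration time -/

/-- The record time `R_k`, which is `⊤` if the walk never enters the corresponding cone. -/
noncomputable def recordTime (p₀ p₁ v : ℝ) (s : Sample) (k : ℕ) : ℕ∞ :=
  sInf {t : ℕ∞ | ∃ n : ℕ, t = n ∧ (1 - v) * k + v * n ≤ (X p₀ p₁ s n : ℝ)}

/-- The regeneration record index `ℐ`: the smallest `k ≥ 1` such that `R_k` is finite and a
regeneration takes place at `Y_{R_k}`; it is `⊤` if there is no such `k`. -/
noncomputable def regenerationIndex (p₀ p₁ v : ℝ) (s : Sample) : ℕ∞ :=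
  sInf {j : ℕ∞ | ∃ k n : ℕ, j = k ∧ 1 ≤ k ∧ recordTime p₀ p₁ v s k = n ∧
    Regenerates p₀ p₁ v s (Y p₀ p₁ s (0, 0) n)}

/-- The regeneration time `τ = R_ℐ`, which is `⊤` if `ℐ = ⊤`. -/
noncomputable def regenerationTime (p₀ p₁ v : ℝ) (s : Sample) : ℕ∞ :=
  match regenerationIndex p₀ p₁ v s with
  | ⊤ => ⊤
  | (k : ℕ) => recordTime p₀ p₁ v s k

/-- The event on which the law `ℙ^∠` is conditioned. -/
def originRegenerates (p₀ p₁ v : ℝ) : Set Sample := {s | Regenerates p₀ p₁ v s (0, 0)}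

/-- The conditional law `ℙ^∠`. -/
noncomputable def coneLaw (p₀ p₁ q : ℝ) (ρ : ℝ≥0) (v : ℝ) : MeasureTheory.Measure Sample :=
  ProbabilityTheory.cond (law q ρ) (originRegenerates p₀ p₁ v)

/-- `exp(c (log t)^γ)` for a time `t ∈ {0, 1, 2, …} ∪ {⊤}`, with value `∞` at `⊤`. -/
noncomputable def expLogPow (c γ : ℝ) : ℕ∞ → ℝ≥0∞
  | ⊤ => ⊤
  | (n : ℕ) => ENNReal.ofReal (Real.exp (c * Real.log n ^ γ))

end RWDRE

/-!
Call `x - v n` the level of a space-time point `(x, n)`. Only environment particles whose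
trajectory joins the backward cone at a point to the cone at another point can transmit information
from the past of the walk to its future, and their number is Poisson. Chernoff bounds make its
mean exponentially small in the difference of the levels of the two points, so a void event has
positive probability. Independently of the past, the walk can also be forced along the diagonal
for a while; thanks to ballisticity this gives regeneration positive probability.

At scale `L`, trials are made at records whose levels are `3 L` apart. In a trial the walk is first
forced to the right for about `log L` steps, which costs a power of `L` but makes it unlikely that
a particle that has avoided the past of the walk spoils the trial. Hence each trial succeeds,
given the failure of the previous ones, with a probability that is bounded below by a power of
`1 / L`, unless a particle links the past to the trial; that happens only on the complement of a
typical event, on which moreover the outcome of every trial is known before the next one starts.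
With a slightly larger power of `L` trials, the probability that all of them fail is exponentially
small in `L`. The dominating error is the probability that the walk lags behind somewhere in a box
of polynomial size, which the ballisticity condition bounds by `exp (-c log ^ γ L)`.
-/

namespace RWDRE

open MeasureTheory ProbabilityTheory Filter Topology

/-- The law of the increments of a two-sided lazy simple random walk. -/
noncomputable def stepLaw (q : ℝ) : Measure (ℤ → ℤ) := Measure.infinitePi fun _ : ℤ => lazyStep q

/-- The two-sided trajectory with increments `η` that is at `z` at time `0`. -/
noncomputable def walkFrom (z : ℤ) (η : ℤ → ℤ) (n : ℤ) : ℤ :=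
  z + ∑ k ∈ Finset.Ico 0 n, η k - ∑ k ∈ Finset.Ico n 0, η k

@[fun_prop]
theorem measurable_walkFrom (z : ℤ) : Measurable (walkFrom z) := by
  refine measurable_pi_lambda _ fun n => ?_
  unfold walkFrom
  fun_prop

theorem path_eq_walkFrom (s : Sample) (z : ℤ) (i : ℕ) :
    path s z i = walkFrom z fun k => s.2.1 (z, i, k) := rfl

theorem measurable_path (z : ℤ) (i : ℕ) : Measurable fun s : Sample => path s z i := by
  simp only [path_eq_walkFrom]
  fun_prop

/-- The intensity measure of the environment, seen as a Poisson point process of trajectories. -/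
noncomputable def intensity (q : ℝ) (ρ : ℝ≥0) : Measure (ℤ → ℤ) :=
  (ρ : ℝ≥0∞) • Measure.sum fun z : ℤ => (stepLaw q).map (walkFrom z)

theorem intensity_apply (q : ℝ) (ρ : ℝ≥0) {B : Set (ℤ → ℤ)} (hB : MeasurableSet B) :
    intensity q ρ B = ∑' z : ℤ, ρ * stepLaw q (walkFrom z ⁻¹' B) := by
  simp only [intensity, Measure.smul_apply, smul_eq_mul, Measure.sum_apply _ hB,
    Measure.map_apply (measurable_walkFrom _) hB, ENNReal.tsum_mul_left]

theorem hasSum_toReal_intensity {q : ℝ} {ρ : ℝ≥0} {B : Set (ℤ → ℤ)} (hB : MeasurableSet B)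
    (hfin : intensity q ρ B ≠ ∞) :
    HasSum (fun z => ρ * (stepLaw q).real (walkFrom z ⁻¹' B)) (intensity q ρ B).toReal := by
  rw [intensity_apply q ρ hB] at hfin ⊢
  simpa [ENNReal.tsum_toReal_eq (ENNReal.ne_top_of_tsum_ne_top hfin), measureReal_def] using
    ENNReal.hasSum_toReal hfin

/-- The event that no environment particle starting in `Z` has its trajectory in `B`. -/
def voidOn (Z : Set ℤ) (B : Set (ℤ → ℤ)) : Set Sample :=
  {s | ∀ z ∈ Z, ∀ i < s.1 z, path s z i ∉ B}

/-- The event that no environment particle has its trajectory in `B`. -/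
def void (B : Set (ℤ → ℤ)) : Set Sample := voidOn Set.univ B

theorem mem_void {s : Sample} {B : Set (ℤ → ℤ)} :
    s ∈ void B ↔ ∀ z, ∀ i < s.1 z, path s z i ∉ B := by
  simp [void, voidOn]

theorem voidOn_anti {Z Z' : Set ℤ} (h : Z ⊆ Z') (B : Set (ℤ → ℤ)) : voidOn Z' B ⊆ voidOn Z B :=
  fun _ hs z hz => hs z (h hz)

theorem iInter_voidOn (B : Set (ℤ → ℤ)) : ⋂ Z : Finset ℤ, voidOn Z B = void B := by
  ext s
  simp only [Set.mem_iInter, mem_void]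
  exact ⟨fun h z => h {z} z (by simp), fun h Z z _ => h z⟩

theorem void_union (B B' : Set (ℤ → ℤ)) : void (B ∪ B') = void B ∩ void B' := by
  ext s
  simp only [mem_void, Set.mem_union, not_or, Set.mem_inter_iff]
  grind

theorem void_empty : void ∅ = Set.univ := by
  ext s
  simp [mem_void]

theorem void_anti {B B' : Set (ℤ → ℤ)} (h : B ⊆ B') : void B' ⊆ void B :=
  fun _ hs z hz i hi hB => hs z hz i hi (h hB)

theorem measurableSet_voidOn (Z : Set ℤ) {B : Set (ℤ → ℤ)} (hB : MeasurableSet B) :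
    MeasurableSet (voidOn Z B) := by
  have : voidOn Z B = ⋂ z ∈ Z, ⋂ i : ℕ, {s : Sample | i < s.1 z}ᶜ ∪ {s | path s z i ∈ B}ᶜ := by
    ext s
    simp only [voidOn, Set.mem_ofPred_eq, Set.mem_iInter, Set.mem_union, Set.mem_compl_iff,
      imp_iff_not_or]
  rw [this]
  refine .biInter (Set.to_countable Z) fun z _ => .iInter fun i => .union ?_ ?_
  · exact (measurableSet_lt measurable_const (by fun_prop)).compl
  · exact (measurable_path z i hB).compl

theorem measurableSet_void {B : Set (ℤ → ℤ)} (hB : MeasurableSet B) : MeasurableSet (void B) :=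
  measurableSet_voidOn _ hB

theorem lintegral_pow_poissonMeasure (ρ : ℝ≥0) {x : ℝ} (hx : 0 ≤ x) :
    ∫⁻ k, ENNReal.ofReal x ^ k ∂poissonMeasure ρ = ENNReal.ofReal (Real.exp (-(ρ * (1 - x)))) := by
  have hsum := (NormedSpace.expSeries_div_hasSum_exp ((ρ : ℝ) * x)).mul_left (Real.exp (-ρ))
  rw [← Real.exp_eq_exp_ℝ, ← Real.exp_add] at hsum
  have hterm (n : ℕ) : ENNReal.ofReal (Real.exp (-ρ) * ρ ^ n / n.factorial) * ENNReal.ofReal x ^ n =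
      ENNReal.ofReal (Real.exp (-ρ) * ((ρ * x) ^ n / n.factorial)) := by
    rw [← ENNReal.ofReal_pow hx, ← ENNReal.ofReal_mul (by positivity), mul_pow]
    ring_nf
  simp only [poissonMeasure, lintegral_sum_measure, lintegral_smul_measure, lintegral_dirac,
    smul_eq_mul, hterm]
  rw [← ENNReal.ofReal_tsum_of_nonneg (fun n => by positivity) hsum.summable, hsum.tsum_eq]
  ring_nf

section Law

variable {q : ℝ} [IsProbabilityMeasure (lazyStep q)] {ρ : ℝ≥0}

instance : IsProbabilityMeasure (stepLaw q) := by unfold stepLaw; infer_instance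

instance : IsProbabilityMeasure (law q ρ) := by unfold law; infer_instance

theorem map_increments : (Measure.infinitePi fun _ : ℤ × ℕ × ℤ => lazyStep q).map
      (fun ξ (p : ℤ × ℕ) (k : ℤ) => ξ (p.1, p.2, k)) =
    Measure.infinitePi fun _ : ℤ × ℕ => stepLaw q := by
  have hassoc := Measure.map_infinitePi_infinitePi_of_inj (P := fun _ : ℤ × ℕ × ℤ => lazyStep q)
    (f := fun p : (ℤ × ℕ) × ℤ => (p.1.1, p.1.2, p.2)) (Equiv.prodAssoc ℤ ℕ ℤ).injective
  have hcurry := Measure.infinitePi_map_curry (fun (_ : ℤ × ℕ) (_ : ℤ) => lazyStep q)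
  rw [← hassoc, Measure.map_map (by fun_prop) (by fun_prop)] at hcurry
  exact hcurry

theorem increments_forall_notMem (n : ℤ → ℕ) (Z : Finset ℤ) {B : Set (ℤ → ℤ)}
    (hB : MeasurableSet B) :
    (Measure.infinitePi fun _ : ℤ × ℕ × ℤ => lazyStep q)
      {ξ | ∀ z ∈ Z, ∀ i < n z, walkFrom z (fun k => ξ (z, i, k)) ∉ B} =
    ∏ z ∈ Z, stepLaw q (walkFrom z ⁻¹' B)ᶜ ^ n z := by
  set F : Finset (ℤ × ℕ) :=
    (Z.sigma fun z => Finset.range (n z)).map (Equiv.sigmaEquivProd ℤ ℕ).toEmbedding with hF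
  have hmem (p : ℤ × ℕ) : p ∈ F ↔ p.1 ∈ Z ∧ p.2 < n p.1 := by
    simp [hF]
  set t : ℤ × ℕ → Set (ℤ → ℤ) := fun p => (walkFrom p.1 ⁻¹' B)ᶜ with ht
  have hmt (p : ℤ × ℕ) : MeasurableSet (t p) := (measurable_walkFrom p.1 hB).compl
  have hbox : {ξ : ℤ × ℕ × ℤ → ℤ | ∀ z ∈ Z, ∀ i < n z, walkFrom z (fun k => ξ (z, i, k)) ∉ B} =
      (fun (ξ : ℤ × ℕ × ℤ → ℤ) (p : ℤ × ℕ) (k : ℤ) => ξ (p.1, p.2, k)) ⁻¹' (F : Set _).pi t := by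
    ext ξ
    simp only [ht, Set.mem_ofPred_eq, Set.mem_preimage, Set.mem_pi, Finset.mem_coe, hmem,
      Prod.forall, Set.mem_compl_iff]
    grind
  rw [hbox, ← Measure.map_apply (by fun_prop) (.pi F.countable_toSet fun p _ => hmt p),
    map_increments, Measure.infinitePi_pi _ fun p _ => hmt p, hF, Finset.prod_map,
    Finset.prod_sigma]
  refine Finset.prod_congr rfl fun z _ => ?_
  simp [ht]

theorem lintegral_prod_pow_poisson (Z : Finset ℤ) {x : ℤ → ℝ} (hx : ∀ z, 0 ≤ x z) :
    ∫⁻ n : ℤ → ℕ, ∏ z ∈ Z, ENNReal.ofReal (x z) ^ n z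
        ∂(Measure.infinitePi fun _ : ℤ => poissonMeasure ρ) =
      ENNReal.ofReal (Real.exp (-∑ z ∈ Z, ρ * (1 - x z))) := by
  rw [lintegral_prod_eq_prod_lintegral_of_indepFun Z
    (fun z (n : ℤ → ℕ) => ENNReal.ofReal (x z) ^ n z)
    (iIndepFun_infinitePi (X := fun z k => ENNReal.ofReal (x z) ^ k) fun _ => .of_discrete)
    (fun z => by fun_prop), ← Finset.sum_neg_distrib, Real.exp_sum,
    ENNReal.ofReal_prod_of_nonneg fun _ _ => Real.exp_nonneg _]
  refine Finset.prod_congr rfl fun z _ => ?_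
  rw [← lintegral_pow_poissonMeasure ρ (hx z)]
  exact (measurePreserving_eval_infinitePi (fun _ : ℤ => poissonMeasure ρ) z).lintegral_comp
    (f := fun k : ℕ => ENNReal.ofReal (x z) ^ k) .of_discrete

theorem law_voidOn_inter (Z : Finset ℤ) {B : Set (ℤ → ℤ)} (hB : MeasurableSet B)
    {C : Set (ℤ × ℤ → unitInterval)} (hC : MeasurableSet C) :
    law q ρ (voidOn Z B ∩ {s | s.2.2 ∈ C}) =
      ENNReal.ofReal (Real.exp (-∑ z ∈ Z, ρ * (stepLaw q).real (walkFrom z ⁻¹' B))) *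
        (Measure.infinitePi fun _ : ℤ × ℤ => (volume : Measure unitInterval)) C := by
  have hslice (n : ℤ → ℕ) : Prod.mk n ⁻¹' (voidOn Z B ∩ {s : Sample | s.2.2 ∈ C}) =
      {ξ : ℤ × ℕ × ℤ → ℤ | ∀ z ∈ Z, ∀ i < n z, walkFrom z (fun k => ξ (z, i, k)) ∉ B} ×ˢ C := by
    ext ⟨ξ, u⟩
    simp [voidOn, path_eq_walkFrom]
  have hcompl (z : ℤ) : stepLaw q (walkFrom z ⁻¹' B)ᶜ =
      ENNReal.ofReal ((stepLaw q).real (walkFrom z ⁻¹' B)ᶜ) :=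
    (ofReal_measureReal (measure_ne_top _ _)).symm
  have hmeas : MeasurableSet (voidOn Z B ∩ {s : Sample | s.2.2 ∈ C}) :=
    (measurableSet_voidOn _ hB).inter (hC.preimage (by fun_prop))
  rw [law, Measure.prod_apply hmeas]
  simp only [hslice, Measure.prod_prod, increments_forall_notMem _ _ hB, hcompl]
  rw [lintegral_mul_const _ (by fun_prop),
    lintegral_prod_pow_poisson Z fun _ => measureReal_nonneg]
  simp only [probReal_compl_eq_one_sub (measurable_walkFrom _ hB), sub_sub_cancel]

theorem law_void_inter {B : Set (ℤ → ℤ)} (hB : MeasurableSet B) (hfin : intensity q ρ B ≠ ∞)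
    {C : Set (ℤ × ℤ → unitInterval)} (hC : MeasurableSet C) :
    law q ρ (void B ∩ {s | s.2.2 ∈ C}) =
      ENNReal.ofReal (Real.exp (-(intensity q ρ B).toReal)) *
        (Measure.infinitePi fun _ : ℤ × ℤ => (volume : Measure unitInterval)) C := by
  have hlim := tendsto_measure_iInter_atTop (μ := law q ρ)
    (s := fun Z : Finset ℤ => voidOn Z B ∩ {s | s.2.2 ∈ C})
    (fun Z => ((measurableSet_voidOn _ hB).inter (hC.preimage (by fun_prop))).nullMeasurableSet)
    (fun Z Z' h => Set.inter_subset_inter_left _ (voidOn_anti (Finset.coe_subset.2 h) B))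
    ⟨∅, measure_ne_top _ _⟩
  rw [← Set.iInter_inter, iInter_voidOn] at hlim
  simp only [Function.comp_def, law_voidOn_inter _ hB hC] at hlim
  refine tendsto_nhds_unique hlim (ENNReal.Tendsto.mul_const ?_ (Or.inr (measure_ne_top _ _)))
  have hsum : Tendsto _ atTop (𝓝 _) := hasSum_toReal_intensity hB hfin
  exact ENNReal.tendsto_ofReal ((Real.continuous_exp.tendsto _).comp hsum.neg)

end Law

theorem walkFrom_zero (z : ℤ) (η : ℤ → ℤ) : walkFrom z η 0 = z := by simp [walkFrom]

theorem walkFrom_add_left (z a : ℤ) (η : ℤ → ℤ) (n : ℤ) :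
    walkFrom (z + a) η n = walkFrom z η n + a := by
  simp only [walkFrom]
  ring

theorem walkFrom_add_one (z : ℤ) (η : ℤ → ℤ) (n : ℤ) :
    walkFrom z η (n + 1) = walkFrom z η n + η n := by
  rcases le_or_gt 0 n with h | h
  · have hneg : Finset.Ico n 0 = ∅ := Finset.Ico_eq_empty (by lia)
    have hneg' : Finset.Ico (n + 1) 0 = ∅ := Finset.Ico_eq_empty (by lia)
    rw [walkFrom, walkFrom, hneg, hneg', ← Finset.insert_Ico_right_eq_Ico_add_one h,
      Finset.sum_insert (by simp)]
    ring
  · have hpos : Finset.Ico 0 n = ∅ := Finset.Ico_eq_empty (by lia)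
    have hpos' : Finset.Ico 0 (n + 1) = ∅ := Finset.Ico_eq_empty (by lia)
    rw [walkFrom, walkFrom, hpos, hpos', ← Finset.insert_Ico_add_one_left_eq_Ico h,
      Finset.sum_insert (by simp)]
    ring

theorem walkFrom_add (z : ℤ) (η : ℤ → ℤ) (n m : ℤ) :
    walkFrom z η (n + m) = walkFrom (walkFrom z η m) (fun k => η (k + m)) n := by
  induction n using Int.induction_on with
  | zero => simp [walkFrom_zero]
  | succ i ih => rw [walkFrom_add_one, ← ih, add_right_comm, walkFrom_add_one]
  | pred i ih =>
    have hleft := walkFrom_add_one z η (-i - 1 + m)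
    have hright := walkFrom_add_one (walkFrom z η m) (fun k => η (k + m)) (-i - 1)
    rw [add_right_comm, sub_add_cancel, ih] at hleft
    rw [sub_add_cancel] at hright
    linarith

/-- The translation of trajectories by the space-time vector `a`. -/
def translate (a : ℤ × ℤ) (w : ℤ → ℤ) (n : ℤ) : ℤ := w (n - a.2) + a.1

theorem measurable_translate (a : ℤ × ℤ) : Measurable (translate a) := by
  unfold translate
  fun_prop

theorem translate_walkFrom (a : ℤ × ℤ) (z : ℤ) (η : ℤ → ℤ) :
    translate a (walkFrom z η) =
      walkFrom (z + (walkFrom 0 η (-a.2) + a.1)) fun k => η (k + -a.2) := by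
  funext n
  rw [translate, sub_eq_add_neg, walkFrom_add, ← walkFrom_add_left]
  congr 1
  rw [← zero_add z, walkFrom_add_left]
  ring

/-- The trajectories that are strictly to the left of the line of slope `v` and level `s` at some
time `≤ t`, and to the right of the line of level `s + h` at some time `≥ t`. -/
def steep (v : ℝ) (t : ℤ) (s h : ℝ) : Set (ℤ → ℤ) :=
  {w | (∃ n ≤ t, (w n : ℝ) - v * n < s) ∧ ∃ n ≥ t, s + h ≤ (w n : ℝ) - v * n}

theorem measurableSet_steep (v : ℝ) (t : ℤ) (s h : ℝ) : MeasurableSet (steep v t s h) := by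
  have hrepr : steep v t s h = (⋃ n ≤ t, {w : ℤ → ℤ | (w n : ℝ) - v * n < s}) ∩
      ⋃ n ≥ t, {w : ℤ → ℤ | s + h ≤ (w n : ℝ) - v * n} := by
    ext w
    simp [steep]
  have hlevel (n : ℤ) : Measurable fun w : ℤ → ℤ => (w n : ℝ) - v * n :=
    ((measurable_of_countable (fun k : ℤ => (k : ℝ))).comp (measurable_pi_apply n)).sub_const _
  rw [hrepr]
  exact .inter (.iUnion fun n => .iUnion fun _ => measurableSet_lt (hlevel n) measurable_const)
    (.iUnion fun n => .iUnion fun _ => measurableSet_le measurable_const (hlevel n))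

theorem translate_preimage_steep (v : ℝ) (t : ℤ) (s h : ℝ) :
    translate (0, -t) ⁻¹' steep v 0 (s + v * t) h = steep v t s h := by
  ext w
  simp only [Set.mem_preimage, steep, translate, Set.mem_ofPred_eq, add_zero, sub_neg_eq_add]
  have hleft (n : ℤ) : (w (n + t) : ℝ) - v * n < s + v * t ↔
      (w (n + t) : ℝ) - v * (n + t : ℤ) < s := by
    push_cast
    constructor <;> intro h <;> linarith
  have hright (n : ℤ) : s + v * t + h ≤ (w (n + t) : ℝ) - v * n ↔
      s + h ≤ (w (n + t) : ℝ) - v * (n + t : ℤ) := by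
    push_cast
    constructor <;> intro h <;> linarith
  simp only [hleft, hright]
  refine and_congr ((Equiv.addRight t).exists_congr_left.trans ?_)
    ((Equiv.addRight t).exists_congr_left.trans ?_) <;> simp

theorem tsum_measure_mem_add {Ω G : Type*} [MeasurableSpace Ω] (μ : Measure Ω) [AddGroup G]
    [Countable G] [MeasurableSpace G] [DiscreteMeasurableSpace G] {E : G → Set Ω}
    (hE : ∀ g, MeasurableSet (E g)) {c : Ω → G} (hc : Measurable c) :
    ∑' g, μ {ω | ω ∈ E (g + c ω)} = ∑' g, μ (E g) := by
  have hE' (g : G) : MeasurableSet {ω | ω ∈ E (g + c ω)} :=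
    measurableSet_setOfPred.2 <|
      (measurable_from_prod_countable_left (f := fun p : Ω × G => p.1 ∈ E (g + p.2))
        fun k => measurableSet_setOfPred.1 (hE (g + k))).comp (measurable_id.prodMk hc)
  simp only [← lintegral_indicator_one (hE _), ← lintegral_indicator_one (hE' _)]
  rw [← lintegral_tsum fun g => (measurable_one.indicator (hE' g)).aemeasurable,
    ← lintegral_tsum fun g => (measurable_one.indicator (hE g)).aemeasurable]
  exact lintegral_congr fun ω =>
    (Equiv.addRight (c ω)).tsum_eq fun g => (E g).indicator (1 : Ω → ℝ≥0∞) ω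

theorem lazyStep_univ (q : ℝ) :
    lazyStep q Set.univ =
      ENNReal.ofReal ((1 - q) / 2) + ENNReal.ofReal q + ENNReal.ofReal ((1 - q) / 2) := by
  simp [lazyStep]

theorem nonneg_of_isProbabilityMeasure_lazyStep (q : ℝ) [IsProbabilityMeasure (lazyStep q)] :
    0 ≤ q := by
  have hmass := lazyStep_univ q
  by_contra! hq
  rw [measure_univ, ENNReal.ofReal_of_nonpos hq.le, add_zero,
    ← ENNReal.ofReal_add (by linarith) (by linarith), add_halves, eq_comm,
    ENNReal.ofReal_eq_one] at hmass
  linarith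

theorem le_one_of_isProbabilityMeasure_lazyStep (q : ℝ) [IsProbabilityMeasure (lazyStep q)] :
    q ≤ 1 := by
  have hmass := lazyStep_univ q
  by_contra! hq
  rw [measure_univ, ENNReal.ofReal_of_nonpos (p := (1 - q) / 2) (by linarith), zero_add, add_zero,
    eq_comm, ENNReal.ofReal_eq_one] at hmass
  linarith

section Law

variable {q : ℝ} [IsProbabilityMeasure (lazyStep q)] {ρ : ℝ≥0}

theorem measurePreserving_shift (m : ℤ) :
    MeasurePreserving (fun (η : ℤ → ℤ) (k : ℤ) => η (k + m)) (stepLaw q) (stepLaw q) where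
  measurable := by fun_prop
  map_eq := Measure.map_infinitePi_infinitePi_of_inj (P := fun _ : ℤ => lazyStep q)
    (add_left_injective m)

theorem intensity_translate_preimage (a : ℤ × ℤ) {B : Set (ℤ → ℤ)} (hB : MeasurableSet B) :
    intensity q ρ (translate a ⁻¹' B) = intensity q ρ B := by
  have hshift := measurePreserving_shift (q := q) (-a.2)
  rw [intensity_apply _ _ (measurable_translate a hB), intensity_apply _ _ hB,
    ENNReal.tsum_mul_left, ENNReal.tsum_mul_left]
  congr 1
  calc ∑' z, stepLaw q (walkFrom z ⁻¹' (translate a ⁻¹' B))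
    _ = ∑' z, stepLaw q {η | η ∈ (fun η k => η (k + -a.2)) ⁻¹'
          (walkFrom (z + (walkFrom 0 η (-a.2) + a.1)) ⁻¹' B)} := by
      simp only [Set.preimage, Set.mem_ofPred_eq, translate_walkFrom]
    _ = ∑' z, stepLaw q ((fun η k => η (k + -a.2)) ⁻¹' (walkFrom z ⁻¹' B)) :=
      tsum_measure_mem_add (stepLaw q) (E := fun z => _ ⁻¹' (walkFrom z ⁻¹' B))
        (fun z => hshift.measurable (measurable_walkFrom z hB)) (by fun_prop)
    _ = ∑' z, stepLaw q (walkFrom z ⁻¹' B) := by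
      simp only [hshift.measure_preimage (measurable_walkFrom _ hB).nullMeasurableSet]

variable (q) in
theorem lintegral_exp_lazyStep_le (θ : ℝ) :
    ∫⁻ x, ENNReal.ofReal (Real.exp (θ * x)) ∂lazyStep q ≤
      ENNReal.ofReal (Real.exp (θ ^ 2 / 2)) := by
  have hq := nonneg_of_isProbabilityMeasure_lazyStep q
  have hq' : 0 ≤ (1 - q) / 2 := by linarith [le_one_of_isProbabilityMeasure_lazyStep q]
  simp only [lazyStep, lintegral_add_measure, lintegral_smul_measure, lintegral_dirac, smul_eq_mul]
  rw [← ENNReal.ofReal_mul hq', ← ENNReal.ofReal_mul hq, ← ENNReal.ofReal_mul hq',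
    ← ENNReal.ofReal_add (by positivity) (by positivity),
    ← ENNReal.ofReal_add (by positivity) (by positivity)]
  refine ENNReal.ofReal_le_ofReal ?_
  have hcosh := Real.cosh_le_exp_half_sq θ
  rw [Real.cosh_eq] at hcosh
  have hone : 1 ≤ Real.exp (θ ^ 2 / 2) := Real.one_le_exp (by positivity)
  simp only [Int.cast_neg, Int.cast_one, mul_neg, mul_one, Int.cast_zero, mul_zero, Real.exp_zero]
  nlinarith

theorem lintegral_exp_sum_le (θ : ℝ) (F : Finset ℤ) :
    ∫⁻ η, ENNReal.ofReal (Real.exp (θ * (∑ k ∈ F, η k : ℤ))) ∂stepLaw q ≤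
      ENNReal.ofReal (Real.exp (θ ^ 2 / 2 * F.card)) := by
  have hmeas : Measurable fun x : ℤ => ENNReal.ofReal (Real.exp (θ * x)) := .of_discrete
  have hfactor (k : ℤ) : ∫⁻ η, ENNReal.ofReal (Real.exp (θ * η k)) ∂stepLaw q ≤
      ENNReal.ofReal (Real.exp (θ ^ 2 / 2)) :=
    ((measurePreserving_eval_infinitePi (fun _ : ℤ => lazyStep q) k).lintegral_comp
      hmeas).trans_le (lintegral_exp_lazyStep_le q θ)
  calc ∫⁻ η, ENNReal.ofReal (Real.exp (θ * (∑ k ∈ F, η k : ℤ))) ∂stepLaw q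
    _ = ∫⁻ η, ∏ k ∈ F, ENNReal.ofReal (Real.exp (θ * η k)) ∂stepLaw q := by
      refine lintegral_congr fun η => ?_
      rw [← ENNReal.ofReal_prod_of_nonneg (fun _ _ => by positivity), ← Real.exp_sum,
        Int.cast_sum, Finset.mul_sum]
    _ = ∏ k ∈ F, ∫⁻ η, ENNReal.ofReal (Real.exp (θ * η k)) ∂stepLaw q :=
      lintegral_prod_eq_prod_lintegral_of_indepFun F _
        (iIndepFun_infinitePi (P := fun _ : ℤ => lazyStep q)
          (X := fun _ x => ENNReal.ofReal (Real.exp (θ * x))) fun _ => hmeas)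
        fun k => hmeas.comp (measurable_pi_apply k)
    _ ≤ ∏ k ∈ F, ENNReal.ofReal (Real.exp (θ ^ 2 / 2)) := Finset.prod_le_prod' fun k _ => hfactor k
    _ = ENNReal.ofReal (Real.exp (θ ^ 2 / 2 * F.card)) := by
      rw [Finset.prod_const, ← ENNReal.ofReal_pow (by positivity), ← Real.exp_nat_mul, mul_comm]

theorem stepLaw_sum_ge_le {v : ℝ} (hv : 0 ≤ v) (r : ℝ) (F : Finset ℤ) :
    stepLaw q {η | r + v * F.card ≤ (∑ k ∈ F, η k : ℤ)} ≤
      ENNReal.ofReal (Real.exp (-(v * r)) * Real.exp (-(v ^ 2 / 2)) ^ F.card) := by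
  have hmeas : Measurable fun η : ℤ → ℤ => ENNReal.ofReal (Real.exp (v * (∑ k ∈ F, η k : ℤ))) :=
    (Measurable.of_discrete (f := fun x : ℤ => ENNReal.ofReal (Real.exp (v * x)))).comp
      (by fun_prop)
  have hsubset : {η : ℤ → ℤ | r + v * F.card ≤ (∑ k ∈ F, η k : ℤ)} ⊆
      {η | ENNReal.ofReal (Real.exp (v * (r + v * F.card))) ≤
        ENNReal.ofReal (Real.exp (v * (∑ k ∈ F, η k : ℤ)))} := fun η hη =>
    ENNReal.ofReal_le_ofReal (Real.exp_le_exp.2 (mul_le_mul_of_nonneg_left hη hv))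
  have hmarkov := (mul_meas_ge_le_lintegral (μ := stepLaw q) hmeas
    (ENNReal.ofReal (Real.exp (v * (r + v * F.card))))).trans (lintegral_exp_sum_le v F)
  have hpos : ENNReal.ofReal (Real.exp (v * (r + v * F.card))) ≠ 0 :=
    (ENNReal.ofReal_pos.2 (Real.exp_pos _)).ne'
  refine (measure_mono hsubset).trans ?_
  rw [← ENNReal.mul_le_mul_iff_right hpos ENNReal.ofReal_ne_top]
  refine hmarkov.trans_eq ?_
  rw [← ENNReal.ofReal_mul (by positivity), ← Real.exp_nat_mul, ← Real.exp_add, ← Real.exp_add]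
  ring_nf

theorem exp_neg_half_sq_lt_one {v : ℝ} (hv : v ≠ 0) : Real.exp (-(v ^ 2 / 2)) < 1 := by
  rw [Real.exp_lt_one_iff, neg_lt_zero]
  positivity

theorem stepLaw_exists_sum_ge_le {v : ℝ} (hv : 0 < v) (r : ℝ) (F : ℕ → Finset ℤ)
    (hF : ∀ n, (F n).card = n) :
    stepLaw q {η | ∃ n : ℕ, r + v * n ≤ (∑ k ∈ F n, η k : ℤ)} ≤
      ENNReal.ofReal ((1 - Real.exp (-(v ^ 2 / 2)))⁻¹ * Real.exp (-(v * r))) := by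
  have hgeom := (hasSum_geometric_of_lt_one (Real.exp_pos _).le
    (exp_neg_half_sq_lt_one hv.ne')).mul_left (Real.exp (-(v * r)))
  calc stepLaw q {η | ∃ n : ℕ, r + v * n ≤ (∑ k ∈ F n, η k : ℤ)}
    _ ≤ ∑' n : ℕ, stepLaw q {η | r + v * n ≤ (∑ k ∈ F n, η k : ℤ)} := by
      rw [Set.ofPred_exists]
      exact measure_iUnion_le _
    _ ≤ ∑' n : ℕ, ENNReal.ofReal (Real.exp (-(v * r)) * Real.exp (-(v ^ 2 / 2)) ^ n) :=
      ENNReal.tsum_le_tsum fun n => by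
        simpa only [hF] using stepLaw_sum_ge_le (q := q) hv.le r (F n)
    _ = ENNReal.ofReal ((1 - Real.exp (-(v ^ 2 / 2)))⁻¹ * Real.exp (-(v * r))) := by
      rw [← ENNReal.ofReal_tsum_of_nonneg (fun n => by positivity) hgeom.summable, hgeom.tsum_eq,
        mul_comm]

theorem stepLaw_steep_le {v : ℝ} (hv : 0 < v) (s h : ℝ) (z : ℤ) :
    stepLaw q (walkFrom z ⁻¹' steep v 0 s h) ≤
      ENNReal.ofReal ((1 - Real.exp (-(v ^ 2 / 2)))⁻¹ *
        Real.exp (-(v * max (z - s) (s + h - z)))) := by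
  rcases max_choice ((z : ℝ) - s) (s + h - z) with hm | hm <;> rw [hm]
  · refine (measure_mono ?_).trans (stepLaw_exists_sum_ge_le hv (z - s)
      (fun n => Finset.Ico (-n : ℤ) 0) (by simp))
    rintro η ⟨⟨n, hn, hw⟩, -⟩
    lift -n to ℕ using neg_nonneg.2 hn with k hk
    obtain rfl : n = -k := by lia
    refine ⟨k, ?_⟩
    rw [walkFrom, Finset.Ico_eq_empty (a := 0) (by lia), Finset.sum_empty] at hw
    push_cast at hw ⊢
    linarith
  · refine (measure_mono ?_).trans (stepLaw_exists_sum_ge_le hv (s + h - z)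
      (fun n => Finset.Ico 0 (n : ℤ)) (by simp))
    rintro η ⟨-, n, hn, hw⟩
    lift n to ℕ using hn
    refine ⟨n, ?_⟩
    rw [walkFrom, Finset.Ico_eq_empty (a := (n : ℤ)) (by lia), Finset.sum_empty] at hw
    push_cast at hw ⊢
    linarith

theorem tsum_exp_neg_abs_ne_top {v : ℝ} (hv : 0 < v) :
    ∑' z : ℤ, ENNReal.ofReal (Real.exp (-(v * |(z : ℝ)|))) ≠ ∞ := by
  have hnat : Summable fun n : ℕ => Real.exp (-(v * n)) := by
    refine (Real.summable_exp_nat_mul_iff.2 (neg_lt_zero.2 hv)).congr fun n => ?_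
    ring_nf
  have hint : Summable fun z : ℤ => Real.exp (-(v * |(z : ℝ)|)) :=
    .of_nat_of_neg (by simpa using hnat) (by simpa using hnat)
  exact hint.tsum_ofReal_ne_top

theorem abs_sub_floor_add_half_add_le_max (z : ℤ) (s h : ℝ) :
    |((z - ⌊s + h / 2⌋ : ℤ) : ℝ)| + h / 2 - 1 ≤ max (z - s) (s + h - z) := by
  have hle := Int.floor_le (s + h / 2)
  have hlt := Int.lt_floor_add_one (s + h / 2)
  push_cast
  rcases abs_cases ((z : ℝ) - ⌊s + h / 2⌋) with ⟨habs, -⟩ | ⟨habs, -⟩ <;> rw [habs]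
  · exact le_max_of_le_left (by linarith)
  · exact le_max_of_le_right (by linarith)

/- Relative to the line, a steep walk from `z` has climbed by `z - s` up to time `0` and climbs by
`s + h - z` after it, and one of these distances is at least `h / 2`. -/
theorem exists_intensity_steep_zero_le {v : ℝ} (hv : 0 < v) :
    ∃ C : ℝ, 0 < C ∧ ∀ s h : ℝ,
      intensity q ρ (steep v 0 s h) ≤ ENNReal.ofReal (C * Real.exp (-(v * h / 2))) := by
  set g : ℝ := (1 - Real.exp (-(v ^ 2 / 2)))⁻¹
  set S := ∑' z : ℤ, ENNReal.ofReal (Real.exp (-(v * |(z : ℝ)|)))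
  have hg : 0 < g := inv_pos.2 (sub_pos.2 (exp_neg_half_sq_lt_one hv.ne'))
  refine ⟨ρ * g * Real.exp v * S.toReal + 1, by positivity, fun s h => ?_⟩
  set m : ℤ := ⌊s + h / 2⌋
  have hterm (z : ℤ) : stepLaw q (walkFrom z ⁻¹' steep v 0 s h) ≤
      ENNReal.ofReal (g * Real.exp (v - v * h / 2)) *
        ENNReal.ofReal (Real.exp (-(v * |((z - m : ℤ) : ℝ)|))) := by
    refine (stepLaw_steep_le hv s h z).trans ?_
    rw [← ENNReal.ofReal_mul (by positivity), mul_assoc, ← Real.exp_add]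
    gcongr
    linarith [mul_le_mul_of_nonneg_left (abs_sub_floor_add_half_add_le_max z s h) hv.le]
  have hcentre : ∑' z : ℤ, ENNReal.ofReal (Real.exp (-(v * |((z - m : ℤ) : ℝ)|))) = S :=
    (Equiv.subRight m).tsum_eq fun z : ℤ => ENNReal.ofReal (Real.exp (-(v * |(z : ℝ)|)))
  rw [intensity_apply _ _ (measurableSet_steep _ _ _ _)]
  calc ∑' z, ρ * stepLaw q (walkFrom z ⁻¹' steep v 0 s h)
    _ ≤ ∑' z, ρ * (ENNReal.ofReal (g * Real.exp (v - v * h / 2)) *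
          ENNReal.ofReal (Real.exp (-(v * |((z - m : ℤ) : ℝ)|)))) := by
      gcongr with z
      exact hterm z
    _ = ENNReal.ofReal (ρ * (g * Real.exp (v - v * h / 2) * S.toReal)) := by
      rw [ENNReal.tsum_mul_left, ENNReal.tsum_mul_left, hcentre,
        ENNReal.ofReal_mul ρ.coe_nonneg, ENNReal.ofReal_mul (q := S.toReal) (by positivity),
        ENNReal.ofReal_toReal (tsum_exp_neg_abs_ne_top hv), ENNReal.ofReal_coe_nnreal]
    _ ≤ ENNReal.ofReal ((ρ * g * Real.exp v * S.toReal + 1) * Real.exp (-(v * h / 2))) := by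
      rw [sub_eq_add_neg, Real.exp_add]
      refine ENNReal.ofReal_le_ofReal ?_
      linarith [Real.exp_pos (-(v * h / 2))]

theorem exists_intensity_steep_le {v : ℝ} (hv : 0 < v) :
    ∃ C : ℝ, 0 < C ∧ ∀ (t : ℤ) (s h : ℝ),
      intensity q ρ (steep v t s h) ≤ ENNReal.ofReal (C * Real.exp (-(v * h / 2))) := by
  obtain ⟨C, hC, hle⟩ := exists_intensity_steep_zero_le (q := q) (ρ := ρ) hv
  refine ⟨C, hC, fun t s h => ?_⟩
  rw [← translate_preimage_steep, intensity_translate_preimage _ (measurableSet_steep _ _ _ _)]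
  exact hle _ _

end Law

theorem isPiSystem_setOf_forall_mem_finset (ι : Type*) :
    IsPiSystem {S : Set (ι → Prop) | ∃ F : Finset ι, S = {e | ∀ i ∈ F, e i}} := by
  classical
  rintro _ ⟨F, rfl⟩ _ ⟨F', rfl⟩ -
  refine ⟨F ∪ F', ?_⟩
  ext e
  simp only [Set.mem_inter_iff, Set.mem_ofPred_eq, Finset.mem_union]
  grind

theorem generateFrom_forall_mem_finset (ι : Type*) :
    MeasurableSpace.generateFrom {S : Set (ι → Prop) | ∃ F : Finset ι, S = {e | ∀ i ∈ F, e i}} =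
      MeasurableSpace.pi := by
  refine le_antisymm (MeasurableSpace.generateFrom_le ?_) ?_
  · rintro _ ⟨F, rfl⟩
    have hbox : {e : ι → Prop | ∀ i ∈ F, e i} = ⋂ i ∈ F, {e | e i} := by
      ext
      simp
    rw [hbox]
    exact F.measurableSet_biInter fun i _ => measurableSet_setOfPred.2 (measurable_pi_apply i)
  · refine iSup_le fun i => measurable_iff_comap_le.1 ?_
    refine @measurable_to_prop _ (MeasurableSpace.generateFrom _) _ ?_
    exact MeasurableSpace.measurableSet_generateFrom ⟨{i}, by ext; simp⟩

theorem measure_ext_of_forall_mem_finset {ι α : Type*} [MeasurableSpace α]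
    {μ ν : Measure ((ι → Prop) × α)} [IsFiniteMeasure μ]
    (h : ∀ (F : Finset ι) (T : Set α), MeasurableSet T →
      μ ({e | ∀ i ∈ F, e i} ×ˢ T) = ν ({e | ∀ i ∈ F, e i} ×ˢ T)) : μ = ν := by
  refine ext_of_generate_finite _ (generateFrom_eq_prod (generateFrom_forall_mem_finset ι)
      MeasurableSpace.generateFrom_measurableSet ?_ isCountablySpanning_measurableSet).symm
    ((isPiSystem_setOf_forall_mem_finset ι).prod MeasurableSpace.isPiSystem_measurableSet) ?_ ?_
  · exact ⟨fun _ => Set.univ, fun _ => ⟨∅, by simp⟩, Set.iUnion_const _⟩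
  · rintro _ ⟨_, ⟨F, rfl⟩, T, hT, rfl⟩
    exact h F T hT
  · simpa using h ∅ Set.univ .univ

/-- The events of the form: no particle has its trajectory in a given `B ⊆ A` of finite intensity,
and the variables `U` in `Z` satisfy a given condition. They form a `π`-system. -/
def patterns (q : ℝ) (ρ : ℝ≥0) (A : Set (ℤ → ℤ)) (Z : Set (ℤ × ℤ)) : Set (Set Sample) :=
  {E | ∃ (B : Set (ℤ → ℤ)) (C : Set (ℤ × ℤ → unitInterval)), MeasurableSet B ∧ B ⊆ A ∧
    intensity q ρ B ≠ ∞ ∧ MeasurableSet[cylinderEvents Z] C ∧ E = void B ∩ {s | s.2.2 ∈ C}}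

/-- The information on the particles with trajectory in `A` and on the variables `U` in `Z`. -/
abbrev observed (q : ℝ) (ρ : ℝ≥0) (A : Set (ℤ → ℤ)) (Z : Set (ℤ × ℤ)) : MeasurableSpace Sample :=
  MeasurableSpace.generateFrom (patterns q ρ A Z)

section Observed

variable {q : ℝ} {ρ : ℝ≥0} {A A' : Set (ℤ → ℤ)} {Z Z' : Set (ℤ × ℤ)}

theorem void_inter_inter_void_inter (B B' : Set (ℤ → ℤ)) (C C' : Set (ℤ × ℤ → unitInterval)) :
    (void B ∩ {s | s.2.2 ∈ C}) ∩ (void B' ∩ {s | s.2.2 ∈ C'}) =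
      void (B ∪ B') ∩ {s | s.2.2 ∈ C ∩ C'} := by
  rw [void_union]
  exact Set.inter_inter_inter_comm _ _ _ _

theorem isPiSystem_patterns : IsPiSystem (patterns q ρ A Z) := by
  rintro _ ⟨B, C, hB, hBA, hfin, hC, rfl⟩ _ ⟨B', C', hB', hBA', hfin', hC', rfl⟩ -
  exact ⟨B ∪ B', C ∩ C', hB.union hB', Set.union_subset hBA hBA',
    measure_union_ne_top hfin hfin', hC.inter hC', void_inter_inter_void_inter B B' C C'⟩

theorem measurableSet_of_mem_patterns {E : Set Sample} (hE : E ∈ patterns q ρ A Z) :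
    MeasurableSet E := by
  obtain ⟨B, C, hB, -, -, hC, rfl⟩ := hE
  exact (measurableSet_void hB).inter ((cylinderEvents_le_pi _ hC).preimage (by fun_prop))

theorem observed_le : observed q ρ A Z ≤ inferInstanceAs (MeasurableSpace Sample) :=
  MeasurableSpace.generateFrom_le fun _ h => measurableSet_of_mem_patterns h

theorem observed_mono (hA : A ⊆ A') (hZ : Z ⊆ Z') : observed q ρ A Z ≤ observed q ρ A' Z' := by
  refine MeasurableSpace.generateFrom_mono ?_
  rintro _ ⟨B, C, hB, hBA, hfin, hC, rfl⟩
  exact ⟨B, C, hB, hBA.trans hA, hfin, cylinderEvents_mono hZ _ hC, rfl⟩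

theorem measurableSet_observed_void {B : Set (ℤ → ℤ)} (hB : MeasurableSet B) (hBA : B ⊆ A)
    (hfin : intensity q ρ B ≠ ∞) : MeasurableSet[observed q ρ A Z] (void B) :=
  MeasurableSpace.measurableSet_generateFrom ⟨B, Set.univ, hB, hBA, hfin, .univ, by simp⟩

theorem measurableSet_observed_uniform {z : ℤ × ℤ} (hz : z ∈ Z) {I : Set unitInterval}
    (hI : MeasurableSet I) : MeasurableSet[observed q ρ A Z] {s : Sample | s.2.2 z ∈ I} :=
  MeasurableSpace.measurableSet_generateFrom
    ⟨∅, (fun u => u z) ⁻¹' I, .empty, Set.empty_subset _, by simp,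
      measurable_cylinderEvent_apply hz hI, by simp [void_empty]⟩

end Observed

/-- The law of the variables `U`. -/
noncomputable abbrev uniformLaw : Measure (ℤ × ℤ → unitInterval) :=
  Measure.infinitePi fun _ : ℤ × ℤ => (volume : Measure unitInterval)

theorem measurePreserving_uniformLaw_shift (a : ℤ × ℤ) :
    MeasurePreserving (fun (u : ℤ × ℤ → unitInterval) z => u (z + a)) uniformLaw uniformLaw where
  measurable := by fun_prop
  map_eq := Measure.map_infinitePi_infinitePi_of_inj
    (P := fun _ : ℤ × ℤ => (volume : Measure unitInterval)) (add_left_injective a)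

theorem indep_cylinderEvents {Z Z' : Set (ℤ × ℤ)} (hZ : Disjoint Z Z') :
    Indep (cylinderEvents Z) (cylinderEvents Z') uniformLaw :=
  indep_iSup_of_disjoint (fun z => (measurable_pi_apply z).comap_le)
    (iIndepFun_infinitePi (P := fun _ : ℤ × ℤ => (volume : Measure unitInterval))
      (X := fun _ => id) fun _ => measurable_id) hZ

/-- The absence of particles in each of the sets of a family. -/
def voids {ι : Type*} (B : ι → Set (ℤ → ℤ)) (s : Sample) (i : ι) : Prop := s ∈ void (B i)

theorem measurable_voids {ι : Type*} {B : ι → Set (ℤ → ℤ)} (hB : ∀ i, MeasurableSet (B i)) :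
    Measurable (voids B) :=
  measurable_pi_lambda _ fun i => measurableSet_setOfPred.1 (measurableSet_void (hB i))

theorem setOf_forall_voids {ι : Type*} (B : ι → Set (ℤ → ℤ)) (F : Finset ι) :
    {s | ∀ i ∈ F, voids B s i} = void (⋃ i ∈ F, B i) := by
  ext s
  simp only [voids, mem_void, Set.mem_iUnion, Set.mem_ofPred_eq, not_exists]
  grind

section Law

variable {q : ℝ} [IsProbabilityMeasure (lazyStep q)] {ρ : ℝ≥0}

theorem law_void {B : Set (ℤ → ℤ)} (hB : MeasurableSet B) (hfin : intensity q ρ B ≠ ∞) :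
    law q ρ (void B) = ENNReal.ofReal (Real.exp (-(intensity q ρ B).toReal)) := by
  simpa using law_void_inter hB hfin (C := Set.univ) .univ

theorem law_uniform {C : Set (ℤ × ℤ → unitInterval)} (hC : MeasurableSet C) :
    law q ρ {s | s.2.2 ∈ C} = uniformLaw C := by
  simpa [void_empty] using law_void_inter (q := q) (ρ := ρ) .empty (by simp) hC

theorem law_void_compl_le {B : Set (ℤ → ℤ)} (hB : MeasurableSet B) :
    law q ρ (void B)ᶜ ≤ intensity q ρ B := by
  rcases eq_or_ne (intensity q ρ B) ∞ with hinf | hfin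
  · simp [hinf]
  rw [prob_compl_eq_one_sub (measurableSet_void hB), law_void hB hfin, ← ENNReal.ofReal_one,
    ← ENNReal.ofReal_sub _ (by positivity)]
  refine ENNReal.ofReal_le_of_le_toReal ?_
  linarith [Real.add_one_le_exp (-(intensity q ρ B).toReal)]

theorem indep_observed {A A' : Set (ℤ → ℤ)} {Z Z' : Set (ℤ × ℤ)} (hA : Disjoint A A')
    (hZ : Disjoint Z Z') : Indep (observed q ρ A Z) (observed q ρ A' Z') (law q ρ) := by
  refine IndepSets.indep' (fun _ h => measurableSet_of_mem_patterns h)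
    (fun _ h => measurableSet_of_mem_patterns h) isPiSystem_patterns isPiSystem_patterns ?_
  rw [IndepSets_iff]
  rintro _ _ ⟨B, C, hB, hBA, hfin, hC, rfl⟩ ⟨B', C', hB', hBA', hfin', hC', rfl⟩
  have hunion : intensity q ρ (B ∪ B') = intensity q ρ B + intensity q ρ B' :=
    measure_union (hA.mono hBA hBA') hB'
  have hinter := Indep_iff _ _ _ |>.1 (indep_cylinderEvents hZ) C C' hC hC'
  replace hC := cylinderEvents_le_pi _ hC
  replace hC' := cylinderEvents_le_pi _ hC'
  rw [void_inter_inter_void_inter,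
    law_void_inter (hB.union hB') (measure_union_ne_top hfin hfin') (hC.inter hC'),
    law_void_inter hB hfin hC, law_void_inter hB' hfin' hC', hunion, hinter,
    ENNReal.toReal_add hfin hfin', neg_add, Real.exp_add, ENNReal.ofReal_mul (by positivity)]
  ring

theorem law_map_voids_apply {ι : Type*} {B : ι → Set (ℤ → ℤ)} (hB : ∀ i, MeasurableSet (B i))
    (hfin : ∀ i, intensity q ρ (B i) ≠ ∞) {f : (ℤ × ℤ → unitInterval) → ℤ × ℤ → unitInterval}
    (hf : MeasurePreserving f uniformLaw uniformLaw) (F : Finset ι)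
    {T : Set (ℤ × ℤ → unitInterval)} (hT : MeasurableSet T) :
    (law q ρ).map (fun s => (voids B s, f s.2.2)) ({e | ∀ i ∈ F, e i} ×ˢ T) =
      ENNReal.ofReal (Real.exp (-(intensity q ρ (⋃ i ∈ F, B i)).toReal)) * uniformLaw T := by
  have hS : MeasurableSet {e : ι → Prop | ∀ i ∈ F, e i} := by
    rw [← generateFrom_forall_mem_finset]
    exact MeasurableSpace.measurableSet_generateFrom ⟨F, rfl⟩
  have hfin' : intensity q ρ (⋃ i ∈ F, B i) ≠ ∞ :=
    (measure_biUnion_lt_top F.finite_toSet fun i _ => (hfin i).lt_top).ne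
  have hpre : (fun s => (voids B s, f s.2.2)) ⁻¹' ({e | ∀ i ∈ F, e i} ×ˢ T) =
      void (⋃ i ∈ F, B i) ∩ {s | s.2.2 ∈ f ⁻¹' T} := by
    rw [← setOf_forall_voids]
    rfl
  have hmeas : Measurable fun s : Sample => (voids B s, f s.2.2) :=
    (measurable_voids hB).prodMk (hf.measurable.comp (by fun_prop))
  rw [Measure.map_apply hmeas (hS.prod hT), hpre,
    law_void_inter (F.measurableSet_biUnion fun i _ => hB i) hfin' (hf.measurable hT),
    hf.measure_preimage hT.nullMeasurableSet]

theorem law_map_voids_eq {ι : Type*} {B B' : ι → Set (ℤ → ℤ)}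
    (hB : ∀ i, MeasurableSet (B i)) (hB' : ∀ i, MeasurableSet (B' i))
    (hfin : ∀ i, intensity q ρ (B i) ≠ ∞)
    (h : ∀ F : Finset ι, intensity q ρ (⋃ i ∈ F, B' i) = intensity q ρ (⋃ i ∈ F, B i))
    {f : (ℤ × ℤ → unitInterval) → ℤ × ℤ → unitInterval}
    (hf : MeasurePreserving f uniformLaw uniformLaw) :
    (law q ρ).map (fun s => (voids B' s, f s.2.2)) = (law q ρ).map fun s => (voids B s, s.2.2) := by
  have hfin' (i : ι) : intensity q ρ (B' i) ≠ ∞ := by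
    have hi := h {i}
    simp only [Finset.mem_singleton, Set.iUnion_iUnion_eq_left] at hi
    exact hi ▸ hfin i
  refine measure_ext_of_forall_mem_finset fun F T hT => ?_
  rw [law_map_voids_apply hB' hfin' hf F hT, h]
  exact (law_map_voids_apply hB hfin (.id _) F hT).symm

end Law

open Classical in
/-- The space-time walk from `y` that steps to the right exactly at the points where `d` holds. -/
noncomputable def walk (d : ℤ × ℤ → Prop) (y : ℤ × ℤ) : ℕ → ℤ × ℤ
  | 0 => y
  | n + 1 => if d (walk d y n) then walk d y n + (1, 1) else walk d y n + (-1, 1)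

/-- The space-time displacement after `l` steps to the right. -/
def diag (l : ℕ) : ℤ × ℤ := (l, l)

@[simp] theorem diag_fst (l : ℕ) : (diag l).1 = l := rfl

@[simp] theorem diag_snd (l : ℕ) : (diag l).2 = l := rfl

@[simp] theorem diag_zero : diag 0 = 0 := rfl

theorem diag_succ (l : ℕ) : diag (l + 1) = diag l + (1, 1) := rfl

section Walk

variable {d d' : ℤ × ℤ → Prop} {y : ℤ × ℤ} {n : ℕ}

@[simp] theorem walk_zero (d : ℤ × ℤ → Prop) (y : ℤ × ℤ) : walk d y 0 = y := rfl

theorem walk_succ_of_pos (h : d (walk d y n)) : walk d y (n + 1) = walk d y n + (1, 1) := by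
  rw [walk, if_pos h]

theorem walk_succ_of_neg (h : ¬d (walk d y n)) : walk d y (n + 1) = walk d y n + (-1, 1) := by
  rw [walk, if_neg h]

theorem walk_succ_cases (d : ℤ × ℤ → Prop) (y : ℤ × ℤ) (n : ℕ) :
    walk d y (n + 1) = walk d y n + (1, 1) ∨ walk d y (n + 1) = walk d y n + (-1, 1) :=
  (em (d (walk d y n))).imp walk_succ_of_pos walk_succ_of_neg

theorem walk_snd (d : ℤ × ℤ → Prop) (y : ℤ × ℤ) (n : ℕ) : (walk d y n).2 = y.2 + n := by
  induction n with
  | zero => simp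
  | succ n ih =>
    rcases walk_succ_cases d y n with h | h <;> simp [h, ih, add_assoc]

theorem abs_walk_fst_sub_le (d : ℤ × ℤ → Prop) (y : ℤ × ℤ) (n : ℕ) :
    |(walk d y n).1 - y.1| ≤ n := by
  induction n with
  | zero => simp
  | succ n ih =>
    rw [abs_le] at ih ⊢
    rcases walk_succ_cases d y n with h | h <;> rw [h] <;> simp only [Prod.fst_add] <;>
      push_cast <;> omega

theorem walk_add (d : ℤ × ℤ → Prop) (y : ℤ × ℤ) (n m : ℕ) :
    walk d y (n + m) = walk d (walk d y n) m := by
  induction m with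
  | zero => rfl
  | succ m ih => rw [← add_assoc, walk, walk, ih]

theorem walk_congr (h : ∀ m < n, d (walk d y m) ↔ d' (walk d y m)) :
    walk d' y n = walk d y n := by
  induction n with
  | zero => rfl
  | succ n ih =>
    have hn := h n n.lt_succ_self
    rw [walk, walk, ih fun m hm => h m (hm.trans n.lt_succ_self), propext hn]

theorem walk_translate (d : ℤ × ℤ → Prop) (a y : ℤ × ℤ) (n : ℕ) :
    walk (fun z => d (z + a)) y n + a = walk d (y + a) n := by
  induction n with
  | zero => rfl
  | succ n ih =>
    rw [walk, walk, ih, ← ih]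
    split_ifs <;> abel

theorem walk_eq_add_diag (h : ∀ l < n, d (y + diag l)) : walk d y n = y + diag n := by
  induction n with
  | zero => simp
  | succ n ih =>
    have hn := ih fun l hl => h l (hl.trans n.lt_succ_self)
    rw [walk_succ_of_pos (hn ▸ h n n.lt_succ_self), hn, diag_succ, add_assoc]

theorem walk_succ_eq_iff {z : ℤ × ℤ} : walk d y (n + 1) = z ↔
    (walk d y n = z - (1, 1) ∧ d (z - (1, 1))) ∨
      (walk d y n = z - (-1, 1) ∧ ¬d (z - (-1, 1))) := by
  rw [walk]
  split_ifs with h <;> rw [← eq_sub_iff_add_eq] <;> grind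

theorem measurable_walk {Ω : Type*} [MeasurableSpace Ω] {d : Ω → ℤ × ℤ → Prop}
    (hd : ∀ z, MeasurableSet {ω | d ω z}) (y : ℤ × ℤ) (n : ℕ) :
    Measurable fun ω => walk (d ω) y n := by
  induction n with
  | zero => exact measurable_const
  | succ n ih =>
    refine measurable_to_countable' fun z => ?_
    have hstep : (fun ω => walk (d ω) y (n + 1)) ⁻¹' {z} =
        ((fun ω => walk (d ω) y n) ⁻¹' {z - (1, 1)} ∩ {ω | d ω (z - (1, 1))}) ∪
        ((fun ω => walk (d ω) y n) ⁻¹' {z - (-1, 1)} ∩ {ω | d ω (z - (-1, 1))}ᶜ) :=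
      Set.ext fun ω => walk_succ_eq_iff
    rw [hstep]
    exact ((ih (measurableSet_singleton _)).inter (hd _)).union
      ((ih (measurableSet_singleton _)).inter (hd _).compl)

end Walk

/-- The level of a space-time point with respect to lines of slope `v`. -/
noncomputable def level (v : ℝ) (z : ℤ × ℤ) : ℝ := z.1 - v * z.2

theorem level_add (v : ℝ) (y z : ℤ × ℤ) : level v (y + z) = level v y + level v z := by
  simp only [level, Prod.fst_add, Prod.snd_add, Int.cast_add]
  ring

theorem level_diag (v : ℝ) (l : ℕ) : level v (diag l) = (1 - v) * l := by
  simp only [level, diag_fst, diag_snd, Int.cast_natCast]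
  ring

theorem level_walk_succ_le (v : ℝ) (d : ℤ × ℤ → Prop) (y : ℤ × ℤ) (n : ℕ) :
    level v (walk d y (n + 1)) ≤ level v (walk d y n) + (1 - v) := by
  rcases walk_succ_cases d y n with h | h <;> rw [h, level_add] <;> simp [level]

theorem level_walk_add_le (v : ℝ) (d : ℤ × ℤ → Prop) (y : ℤ × ℤ) (n m : ℕ) :
    level v (walk d y (n + m)) ≤ level v (walk d y n) + (1 - v) * m := by
  induction m with
  | zero => simp
  | succ m ih =>
    have hstep := level_walk_succ_le v d y (n + m)
    rw [← add_assoc]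
    push_cast
    linarith

section Cones

variable {v : ℝ} {y z : ℤ × ℤ}

theorem mem_cone_iff (hv : 0 ≤ v) : z ∈ cone v y ↔ y.2 ≤ z.2 ∧ level v y ≤ level v z := by
  have hlevel : v * ((z.2 - y.2 : ℤ) : ℝ) ≤ ((z.1 - y.1 : ℤ) : ℝ) ↔ level v y ≤ level v z := by
    rw [level, level, ← sub_nonneg, ← sub_nonneg (a := (z.1 - v * z.2 : ℝ))]
    push_cast
    ring_nf
  rw [← hlevel, ← sub_nonneg (a := z.2)]
  refine ⟨fun h => h.2, fun ⟨htime, h⟩ => ⟨?_, htime, h⟩⟩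
  exact_mod_cast (mul_nonneg hv (Int.cast_nonneg htime)).trans h

theorem mem_backCone_iff (hv : 0 ≤ v) :
    z ∈ backCone v y ↔ z.2 ≤ y.2 ∧ level v z < level v y := by
  have hlevel : ((z.1 - y.1 : ℤ) : ℝ) < v * ((z.2 - y.2 : ℤ) : ℝ) ↔ level v z < level v y := by
    rw [level, level, ← sub_pos, ← sub_pos (a := (y.1 - v * y.2 : ℝ))]
    push_cast
    ring_nf
  rw [← hlevel, ← sub_nonpos (a := z.2)]
  refine ⟨fun h => h.2, fun ⟨htime, h⟩ => ⟨?_, htime, h⟩⟩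
  exact_mod_cast h.le.trans (mul_nonpos_of_nonneg_of_nonpos hv (Int.cast_nonpos.2 htime))

theorem cone_translate (v : ℝ) (a y z : ℤ × ℤ) : z + a ∈ cone v (y + a) ↔ z ∈ cone v y := by
  simp [cone]

theorem backCone_translate (v : ℝ) (a y z : ℤ × ℤ) :
    z + a ∈ backCone v (y + a) ↔ z ∈ backCone v y := by
  simp [backCone]

theorem cone_subset (hv : 0 ≤ v) (h : z ∈ cone v y) : cone v z ⊆ cone v y := by
  intro w hw
  rw [mem_cone_iff hv] at *
  exact ⟨h.1.trans hw.1, h.2.trans hw.2⟩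

theorem backCone_subset (hv : 0 ≤ v) (h : z ∈ cone v y) : backCone v y ⊆ backCone v z := by
  intro w hw
  rw [mem_cone_iff hv] at h
  rw [mem_backCone_iff hv] at *
  exact ⟨hw.1.trans h.1, hw.2.trans_le h.2⟩

theorem backCone_subset_of_mem (hv : 0 ≤ v) (h : z ∈ backCone v y) :
    backCone v z ⊆ backCone v y := by
  intro w hw
  rw [mem_backCone_iff hv] at *
  exact ⟨hw.1.trans h.1, hw.2.trans h.2⟩

theorem disjoint_cone_backCone (hv : 0 ≤ v) (y : ℤ × ℤ) : Disjoint (cone v y) (backCone v y) := by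
  rw [Set.disjoint_left]
  intro z hcone hback
  rw [mem_cone_iff hv] at hcone
  rw [mem_backCone_iff hv] at hback
  exact hback.2.not_ge hcone.2

theorem add_diag_mem_cone (hv : 0 ≤ v) (hv1 : v ≤ 1) (y : ℤ × ℤ) (l : ℕ) :
    y + diag l ∈ cone v y := by
  rw [mem_cone_iff hv, level_add, level_diag]
  exact ⟨by simp, le_add_of_nonneg_right (mul_nonneg (sub_nonneg.2 hv1) l.cast_nonneg)⟩

end Cones

/-- The trajectories through a given space-time point. -/
def through (z : ℤ × ℤ) : Set (ℤ → ℤ) := {w | w z.2 = z.1}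

/-- The trajectories that meet a given set of space-time points. -/
def meeting (D : Set (ℤ × ℤ)) : Set (ℤ → ℤ) := {w | ∃ n : ℤ, (w n, n) ∈ D}

/-- The trajectories that meet the backward cone at `y` and the cone at `z`. -/
def link (v : ℝ) (y z : ℤ × ℤ) : Set (ℤ → ℤ) := meeting (backCone v y) ∩ meeting (cone v z)

theorem measurableSet_through (z : ℤ × ℤ) : MeasurableSet (through z) :=
  measurableSet_eq_fun (measurable_pi_apply z.2) measurable_const

theorem measurableSet_meeting (D : Set (ℤ × ℤ)) : MeasurableSet (meeting D) := by
  have hunion : meeting D = ⋃ n : ℤ, (fun w : ℤ → ℤ => w n) ⁻¹' {x | (x, n) ∈ D} := by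
    ext
    simp [meeting]
  rw [hunion]
  exact .iUnion fun n => (measurable_pi_apply n) (.of_discrete)

theorem measurableSet_link (v : ℝ) (y z : ℤ × ℤ) : MeasurableSet (link v y z) :=
  (measurableSet_meeting _).inter (measurableSet_meeting _)

theorem meeting_mono {D D' : Set (ℤ × ℤ)} (h : D ⊆ D') : meeting D ⊆ meeting D' :=
  fun _ ⟨n, hn⟩ => ⟨n, h hn⟩

theorem link_subset_union {v : ℝ} {z z' : ℤ × ℤ} (h : cone v z' ⊆ cone v z) (y : ℤ × ℤ) :
    link v z z' ⊆ (link v z z' \ meeting (backCone v y)) ∪ link v y z := fun w hw =>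
  (em (w ∈ meeting (backCone v y))).symm.imp (⟨hw, ·⟩) (⟨·, meeting_mono h hw.2⟩)

theorem through_subset_meeting {D : Set (ℤ × ℤ)} {z : ℤ × ℤ} (hz : z ∈ D) :
    through z ⊆ meeting D := by
  intro w hw
  refine ⟨z.2, ?_⟩
  rw [through, Set.mem_ofPred_eq] at hw
  rwa [hw]

theorem link_subset_steep {v : ℝ} (hv : 0 ≤ v) {y z : ℤ × ℤ} (h : y.2 ≤ z.2) :
    link v y z ⊆ steep v y.2 (level v y) (level v z - level v y) := by
  rintro w ⟨⟨n, hn⟩, n', hn'⟩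
  rw [mem_backCone_iff hv] at hn
  rw [mem_cone_iff hv] at hn'
  refine ⟨⟨n, hn.1, hn.2⟩, n', h.trans hn'.1, ?_⟩
  rw [add_sub_cancel]
  exact hn'.2

theorem crossing_subset_link (v : ℝ) (y : ℤ × ℤ) : crossing v y ⊆ link v y y :=
  fun _ ⟨_, hcone, hback⟩ => ⟨hback, hcone⟩

theorem omega_eq_zero_iff {s : Sample} {A : Set (ℤ → ℤ)} : omega s A = 0 ↔ s ∈ void A := by
  simp only [omega, Set.encard_eq_zero, Set.eq_empty_iff_forall_notMem, mem_void,
    Set.mem_ofPred_eq, Prod.forall, not_and]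

theorem mem_trace_iff {s : Sample} {z : ℤ × ℤ} : z ∈ trace s ↔ s ∉ void (through z) := by
  simp only [trace, mem_void, through, Set.mem_ofPred_eq]
  push Not
  rfl

/-- Whether the walk steps to the right at a point that is free of particles if `vacant` holds and
where the variable `U` takes the value `u`. -/
def stepsRight (p₀ p₁ : ℝ) (vacant : Prop) (u : unitInterval) : Prop :=
  (¬vacant ∧ (u : ℝ) ≤ p₁) ∨ (vacant ∧ (u : ℝ) ≤ p₀)

/-- The direction at `z` when only particles with trajectory in `A` are taken into account. Outside
of `Z` the direction is left. -/
def dirOn (p₀ p₁ : ℝ) (A : Set (ℤ → ℤ)) (Z : Set (ℤ × ℤ)) (s : Sample) (z : ℤ × ℤ) : Prop :=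
  z ∈ Z ∧ stepsRight p₀ p₁ (s ∈ void (through z ∩ A)) (s.2.2 z)

/-- The direction of the walk at `z`. -/
def dir (p₀ p₁ : ℝ) (s : Sample) (z : ℤ × ℤ) : Prop :=
  stepsRight p₀ p₁ (s ∈ void (through z)) (s.2.2 z)

section Directions

variable {p₀ p₁ : ℝ} {s : Sample} {z : ℤ × ℤ}

theorem stepsRight_of_le_min {vacant : Prop} {u : unitInterval} (h : (u : ℝ) ≤ min p₀ p₁) :
    stepsRight p₀ p₁ vacant u := by
  rw [le_min_iff] at h
  simp only [stepsRight, h, and_true]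
  exact (em vacant).symm

theorem Y_eq_walk (p₀ p₁ : ℝ) (s : Sample) (y : ℤ × ℤ) (n : ℕ) :
    Y p₀ p₁ s y n = walk (dir p₀ p₁ s) y n := by
  induction n with
  | zero => rfl
  | succ n ih =>
    rw [Y, walk, ih]
    congr 1
    simp [dir, stepsRight, mem_trace_iff]

theorem dirOn_iff_dir {A : Set (ℤ → ℤ)} {Z : Set (ℤ × ℤ)} (hz : z ∈ Z)
    (h : s ∈ void (through z \ A)) : dirOn p₀ p₁ A Z s z ↔ dir p₀ p₁ s z := by
  have hvoid : s ∈ void (through z ∩ A) ↔ s ∈ void (through z) := by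
    conv_rhs => rw [← Set.inter_union_sdiff (through z) A, void_union]
    exact (and_iff_left h).symm
  simp only [dirOn, dir, hz, hvoid, true_and]

theorem measurable_stepsRight (p₀ p₁ : ℝ) :
    Measurable fun e : Prop × unitInterval => stepsRight p₀ p₁ e.1 e.2 := by
  have hvacant : MeasurableSet {e : Prop × unitInterval | e.1} :=
    measurableSet_setOfPred.2 measurable_fst
  have huniform (p : ℝ) : MeasurableSet {e : Prop × unitInterval | (e.2 : ℝ) ≤ p} :=
    measurableSet_le (by fun_prop) measurable_const
  exact measurableSet_setOfPred.1
    ((hvacant.compl.inter (huniform p₁)).union (hvacant.inter (huniform p₀)))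

end Directions

theorem translate_preimage_through (a z : ℤ × ℤ) :
    translate a ⁻¹' through (z + a) = through z := by
  ext w
  simp [translate, through]

theorem translate_preimage_meeting {a : ℤ × ℤ} {D D' : Set (ℤ × ℤ)}
    (h : ∀ z, z + a ∈ D' ↔ z ∈ D) : translate a ⁻¹' meeting D' = meeting D := by
  ext w
  simp only [meeting, translate, Set.mem_preimage, Set.mem_ofPred_eq]
  exact (Equiv.addRight a.2).surjective.exists.trans
    (exists_congr fun n => by simpa [Prod.add_def] using h (w n, n))

theorem translate_preimage_link (v : ℝ) (a y z : ℤ × ℤ) :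
    translate a ⁻¹' link v (y + a) (z + a) = link v y z := by
  rw [link, Set.preimage_inter, translate_preimage_meeting (backCone_translate v a y),
    translate_preimage_meeting (cone_translate v a z), link]

/-- The sets of trajectories whose presence determines the directions of the walk and the
possible regeneration points: those through a point and those linking a point to itself. -/
def obstacles (v : ℝ) : (ℤ × ℤ) ⊕ (ℤ × ℤ) → Set (ℤ → ℤ) := Sum.elim through fun y => link v y y

theorem measurableSet_obstacles (v : ℝ) (i : (ℤ × ℤ) ⊕ (ℤ × ℤ)) :
    MeasurableSet (obstacles v i) := by
  rcases i with z | y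
  · exact measurableSet_through z
  · exact measurableSet_link v y y

theorem translate_preimage_obstacles (v : ℝ) (a : ℤ × ℤ) (i : (ℤ × ℤ) ⊕ (ℤ × ℤ)) :
    translate a ⁻¹' obstacles v (i.map (· + a) (· + a)) = obstacles v i := by
  rcases i with z | y
  · exact translate_preimage_through a z
  · exact translate_preimage_link v a y y

section Law

variable {q : ℝ} [IsProbabilityMeasure (lazyStep q)] {ρ : ℝ≥0}

theorem intensity_through (z : ℤ × ℤ) : intensity q ρ (through z) ≠ ∞ := by
  have hshift : intensity q ρ (through z) = intensity q ρ (through 0) := by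
    rw [← intensity_translate_preimage z (measurableSet_through z),
      ← translate_preimage_through z 0, zero_add]
  rw [hshift, intensity_apply q ρ (measurableSet_through 0), tsum_eq_single 0]
  · finiteness
  · intro x hx
    simp [through, walkFrom_zero, hx]

theorem exists_intensity_link_le {v : ℝ} (hv : 0 < v) :
    ∃ C : ℝ, 0 < C ∧ ∀ y z : ℤ × ℤ, y.2 ≤ z.2 → intensity q ρ (link v y z) ≤
      ENNReal.ofReal (C * Real.exp (-(v * (level v z - level v y) / 2))) := by
  obtain ⟨C, hC, hsteep⟩ := exists_intensity_steep_le (q := q) (ρ := ρ) hv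
  exact ⟨C, hC, fun y z hyz => (measure_mono (link_subset_steep hv.le hyz)).trans (hsteep _ _ _)⟩

theorem intensity_link {v : ℝ} (hv : 0 < v) {y z : ℤ × ℤ} (hyz : y.2 ≤ z.2) :
    intensity q ρ (link v y z) ≠ ∞ := by
  obtain ⟨C, -, hlink⟩ := exists_intensity_link_le (q := q) (ρ := ρ) hv
  exact ((hlink y z hyz).trans_lt ENNReal.ofReal_lt_top).ne

theorem measurableSet_dirOn (p₀ p₁ : ℝ) {A : Set (ℤ → ℤ)} (hA : MeasurableSet A)
    (Z : Set (ℤ × ℤ)) (z : ℤ × ℤ) :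
    MeasurableSet[observed q ρ A Z] {s | dirOn p₀ p₁ A Z s z} := by
  by_cases hz : z ∈ Z
  · let := observed q ρ A Z
    have hvoid : Measurable[observed q ρ A Z] fun s => s ∈ void (through z ∩ A) :=
      measurableSet_setOfPred.1 <|
        measurableSet_observed_void ((measurableSet_through z).inter hA) Set.inter_subset_right
          (measure_ne_top_of_subset Set.inter_subset_left (intensity_through z))
    have huniform : Measurable[observed q ρ A Z] fun s : Sample => s.2.2 z :=
      fun I hI => measurableSet_observed_uniform hz hI
    simpa only [dirOn, hz, true_and, Function.comp_def] using measurableSet_setOfPred.2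
      ((measurable_stepsRight p₀ p₁).comp (hvoid.prodMk huniform))
  · simp [dirOn, hz]

theorem measurable_walk_dirOn (p₀ p₁ : ℝ) {A : Set (ℤ → ℤ)} (hA : MeasurableSet A)
    (Z : Set (ℤ × ℤ)) (y : ℤ × ℤ) (n : ℕ) :
    Measurable[observed q ρ A Z] fun s => walk (dirOn p₀ p₁ A Z s) y n :=
  @measurable_walk _ (observed q ρ A Z) _ (measurableSet_dirOn p₀ p₁ hA Z) y n

theorem law_map_voids_obstacles_shift {v : ℝ} (hv : 0 < v) (a : ℤ × ℤ) :
    (law q ρ).map (fun s => (voids (fun i => obstacles v (i.map (· + a) (· + a))) s,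
        fun z => s.2.2 (z + a))) =
      (law q ρ).map fun s => (voids (obstacles v) s, s.2.2) := by
  have hfin (i : (ℤ × ℤ) ⊕ (ℤ × ℤ)) : intensity q ρ (obstacles v i) ≠ ∞ := by
    rcases i with z | y
    · exact intensity_through z
    · exact intensity_link hv le_rfl
  refine law_map_voids_eq (measurableSet_obstacles v) (fun _ => measurableSet_obstacles v _) hfin
    (fun F => ?_) (measurePreserving_uniformLaw_shift a)
  rw [← intensity_translate_preimage a
    (F.measurableSet_biUnion fun _ _ => measurableSet_obstacles v _)]
  simp only [Set.preimage_iUnion, translate_preimage_obstacles]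

theorem law_shift {v : ℝ} (hv : 0 < v) (p₀ p₁ : ℝ) (a : ℤ × ℤ)
    {S : Set ((ℤ × ℤ → Prop) × (ℤ × ℤ → Prop))} (hS : MeasurableSet S) :
    law q ρ {s | (fun z => dir p₀ p₁ s (z + a),
        fun y => s ∈ void (link v (y + a) (y + a))) ∈ S} =
      law q ρ {s | (dir p₀ p₁ s, fun y => s ∈ void (link v y y)) ∈ S} := by
  set read : ((ℤ × ℤ) ⊕ (ℤ × ℤ) → Prop) × (ℤ × ℤ → unitInterval) →
      (ℤ × ℤ → Prop) × (ℤ × ℤ → Prop) :=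
    fun e => (fun z => stepsRight p₀ p₁ (e.1 (.inl z)) (e.2 z), fun y => e.1 (.inr y))
  have hread : Measurable read := by
    refine .prodMk (measurable_pi_lambda _ fun z => ?_) (by fun_prop)
    exact (measurable_stepsRight p₀ p₁).fun_comp (.prodMk (by fun_prop) (by fun_prop))
  have hmap := congrArg (· (read ⁻¹' S)) (law_map_voids_obstacles_shift (q := q) (ρ := ρ) hv a)
  rwa [Measure.map_apply ((measurable_voids fun _ => measurableSet_obstacles v _).prodMk
      (by fun_prop)) (hread hS),
    Measure.map_apply ((measurable_voids (measurableSet_obstacles v)).prodMk (by fun_prop))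
      (hread hS)] at hmap

end Law

/-- The walk from `y` stays in the cone at `y`, and no particle links the backward cone at `y` to
the cone at `y`. This is contained in the event `Regenerates`, where only nearest-neighbour
trajectories are excluded. -/
def regen (p₀ p₁ v : ℝ) (y : ℤ × ℤ) : Set Sample :=
  void (link v y y) ∩ {s | ∀ i, walk (dir p₀ p₁ s) y i ∈ cone v y}

theorem regenerates_of_mem_regen {p₀ p₁ v : ℝ} {y : ℤ × ℤ} {s : Sample}
    (h : s ∈ regen p₀ p₁ v y) : Regenerates p₀ p₁ v s y :=
  ⟨omega_eq_zero_iff.2 (void_anti (crossing_subset_link v y) h.1),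
    fun i => Y_eq_walk p₀ p₁ s y i ▸ h.2 i⟩

/-- The walk from `y` lags behind speed `vstar` by more than `L`. -/
def lagging (p₀ p₁ vstar : ℝ) (L : ℕ) (y : ℤ × ℤ) : Set Sample :=
  {s | ∃ n : ℕ, 1 ≤ n ∧ ((walk (dir p₀ p₁ s) y n).1 : ℝ) - y.1 < n * vstar - L}

theorem le_walk_fst_of_notMem_lagging {p₀ p₁ vstar : ℝ} {L : ℕ} {y : ℤ × ℤ} {s : Sample}
    (hs : s ∉ lagging p₀ p₁ vstar L y) (n : ℕ) :
    (n : ℝ) * vstar - L ≤ ((walk (dir p₀ p₁ s) y n).1 : ℝ) - y.1 := by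
  rcases Nat.eq_zero_or_pos n with rfl | hn
  · simp
  · exact not_lt.1 fun hlag => hs ⟨n, hn, hlag⟩

theorem walk_mem_cone_of_notMem_lagging {p₀ p₁ v vstar : ℝ} (hv : 0 ≤ v) (hvstar : v ≤ vstar)
    {L : ℕ} {y z : ℤ × ℤ} (htime : z.2 ≤ y.2) (hlevel : level v z + L ≤ level v y) {s : Sample}
    (hs : s ∉ lagging p₀ p₁ vstar L y) (n : ℕ) : walk (dir p₀ p₁ s) y n ∈ cone v z := by
  have hfst := le_walk_fst_of_notMem_lagging hs n
  have hslope : (n : ℝ) * v ≤ n * vstar := by gcongr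
  rw [mem_cone_iff hv, walk_snd]
  refine ⟨by omega, ?_⟩
  simp only [level, walk_snd] at hlevel ⊢
  push_cast
  linarith

/-- The variables `U` make the walk step to the right at the first `K` points of the diagonal
at `y`, whatever the environment. -/
def diagonal (p₀ p₁ : ℝ) (K : ℕ) (y : ℤ × ℤ) : Set Sample :=
  {s | ∀ l < K, (s.2.2 (y + diag l) : ℝ) ≤ min p₀ p₁}

theorem walk_of_mem_diagonal {p₀ p₁ : ℝ} {K : ℕ} {y : ℤ × ℤ} {s : Sample}
    (h : s ∈ diagonal p₀ p₁ K y) {l : ℕ} (hl : l ≤ K) : walk (dir p₀ p₁ s) y l = y + diag l :=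
  walk_eq_add_diag fun m hm => stepsRight_of_le_min (h m (hm.trans_le hl))

/-- Probability that a uniform variable forces a step to the right. -/
noncomputable def forceProb (p₀ p₁ : ℝ) : ℝ≥0∞ :=
  (volume : Measure unitInterval) {u | (u : ℝ) ≤ min p₀ p₁}

theorem forceProb_ne_zero {p₀ p₁ : ℝ} (hp₀ : 0 < p₀) (hp₁ : 0 < p₁) : forceProb p₀ p₁ ≠ 0 := by
  have hp : 0 < min (min p₀ p₁) 1 := lt_min (lt_min hp₀ hp₁) one_pos
  have hsub : Set.Iic (⟨min (min p₀ p₁) 1, hp.le, min_le_right _ _⟩ : unitInterval) ⊆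
      {u | (u : ℝ) ≤ min p₀ p₁} := fun u hu =>
    (show (u : ℝ) ≤ min (min p₀ p₁) 1 from hu).trans (min_le_left _ _)
  refine (lt_of_lt_of_le ?_ (measure_mono hsub)).ne'
  rw [unitInterval.volume_Iic]
  exact ENNReal.ofReal_pos.2 hp

theorem measurableSet_force (p₀ p₁ : ℝ) :
    MeasurableSet {u : unitInterval | (u : ℝ) ≤ min p₀ p₁} :=
  measurableSet_le measurable_subtype_coe measurable_const

theorem measurableSet_diagonal {q : ℝ} {ρ : ℝ≥0} (p₀ p₁ : ℝ) {K : ℕ} {y : ℤ × ℤ}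
    {A : Set (ℤ → ℤ)} {Z : Set (ℤ × ℤ)} (h : ∀ l < K, y + diag l ∈ Z) :
    MeasurableSet[observed q ρ A Z] (diagonal p₀ p₁ K y) := by
  simp only [diagonal, Set.ofPred_forall]
  exact .iInter fun l => .iInter fun hl =>
    measurableSet_observed_uniform (h l hl) (measurableSet_force p₀ p₁)

/-- The version of `regen` at the diagonal point `y + (K, K)` that ignores the particles which meet
the backward cone at `y`. -/
def freshRegen (p₀ p₁ v : ℝ) (K : ℕ) (y : ℤ × ℤ) : Set Sample :=
  void (link v (y + diag K) (y + diag K) \ meeting (backCone v y)) ∩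
    {s | ∀ i, walk (dirOn p₀ p₁ (meeting (backCone v y))ᶜ (cone v (y + diag K)) s)
      (y + diag K) i ∈ cone v (y + diag K)}

theorem regen_subset_freshRegen {p₀ p₁ v : ℝ} (hv : 0 ≤ v) (hv1 : v ≤ 1) (K : ℕ) (y : ℤ × ℤ) :
    regen p₀ p₁ v (y + diag K) ⊆ freshRegen p₀ p₁ v K y := by
  rintro s ⟨hvoid, hstay⟩
  refine ⟨void_anti Set.sdiff_subset hvoid, fun i => ?_⟩
  rw [walk_congr (d := dir p₀ p₁ s)]
  · exact hstay i
  intro m _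
  refine (dirOn_iff_dir (hstay m) (void_anti ?_ hvoid)).symm
  rw [sdiff_compl]
  exact fun w hw => ⟨meeting_mono (backCone_subset hv (add_diag_mem_cone hv hv1 y K)) hw.2,
    through_subset_meeting (hstay m) hw.1⟩

theorem freshRegen_inter_subset_regen (p₀ p₁ v : ℝ) (K : ℕ) (y : ℤ × ℤ) :
    freshRegen p₀ p₁ v K y ∩ void (link v y (y + diag K)) ⊆ regen p₀ p₁ v (y + diag K) := by
  rintro s ⟨⟨hfresh, hstay⟩, hlink⟩
  refine ⟨void_anti (link_subset_union subset_rfl y) (void_union _ _ ▸ ⟨hfresh, hlink⟩),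
    fun i => ?_⟩
  rw [walk_congr (d' := dir p₀ p₁ s) fun m _ => dirOn_iff_dir (hstay m) (void_anti ?_ hlink)]
  · exact hstay i
  rw [sdiff_compl]
  exact fun w hw => ⟨hw.2, through_subset_meeting (hstay m) hw.1⟩

theorem walk_dirOn_univ (p₀ p₁ : ℝ) (s : Sample) (y : ℤ × ℤ) (n : ℕ) :
    walk (dirOn p₀ p₁ Set.univ {z | y.2 ≤ z.2} s) y n = walk (dir p₀ p₁ s) y n := by
  refine walk_congr fun m _ => (dirOn_iff_dir ?_ ?_).symm
  · simp [walk_snd]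
  · simp [void_empty]

theorem diagonal_inter_subset_regen {p₀ p₁ v : ℝ} (hv : 0 ≤ v) (hv1 : v ≤ 1) (K : ℕ)
    (y : ℤ × ℤ) :
    diagonal p₀ p₁ K y ∩ (void (link v y y) ∩
      {s | ∀ n, walk (dir p₀ p₁ s) (y + diag K) n ∈ cone v y}) ⊆ regen p₀ p₁ v y := by
  rintro s ⟨hdiag, hvoid, hstay⟩
  refine ⟨hvoid, fun i => ?_⟩
  rcases le_total i K with hi | hi
  · rw [walk_of_mem_diagonal hdiag hi]
    exact add_diag_mem_cone hv hv1 y i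
  · obtain ⟨j, rfl⟩ := Nat.exists_eq_add_of_le hi
    rw [walk_add, walk_of_mem_diagonal hdiag le_rfl]
    exact hstay j

theorem measurable_walk_of_fst (y : ℤ × ℤ) (n : ℕ) :
    Measurable fun e : (ℤ × ℤ → Prop) × (ℤ × ℤ → Prop) => walk e.1 y n :=
  measurable_walk (fun z => measurableSet_setOfPred.2 (by fun_prop)) y n

theorem tendsto_exp_neg_log_rpow {c₀ γ : ℝ} (hc₀ : 0 < c₀) (hγ : 0 < γ) :
    Tendsto (fun L : ℕ => c₀⁻¹ * Real.exp (-c₀ * Real.log L ^ γ)) atTop (𝓝 0) := by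
  have hlog : Tendsto (fun L : ℕ => Real.log L ^ γ) atTop atTop :=
    (tendsto_rpow_atTop hγ).comp (Real.tendsto_log_atTop.comp tendsto_natCast_atTop_atTop)
  simpa using (Real.tendsto_exp_atBot.comp
    (hlog.const_mul_atTop_of_neg (neg_neg_of_pos hc₀))).const_mul c₀⁻¹

section Law

variable {q : ℝ} [IsProbabilityMeasure (lazyStep q)] {ρ : ℝ≥0}

theorem law_lagging (p₀ p₁ vstar : ℝ) (L : ℕ) (y : ℤ × ℤ) :
    law q ρ (lagging p₀ p₁ vstar L y) = law q ρ (lagging p₀ p₁ vstar L 0) := by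
  have hS : MeasurableSet {e : (ℤ × ℤ → Prop) × (ℤ × ℤ → Prop) |
      ∃ n : ℕ, 1 ≤ n ∧ ((walk e.1 0 n).1 : ℝ) < n * vstar - L} := by
    simp only [Set.ofPred_exists, Set.ofPred_and]
    exact .iUnion fun n => .inter (.const _)
      (measurable_walk_of_fst 0 n (t := {z | ((z.1 : ℤ) : ℝ) < n * vstar - L}) .of_discrete)
  convert! law_shift (q := q) (ρ := ρ) one_pos p₀ p₁ y hS using 2
  · ext s
    have htranslate (n : ℕ) : (walk (dir p₀ p₁ s) y n).1 =
        (walk (fun z => dir p₀ p₁ s (z + y)) 0 n).1 + y.1 := by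
      rw [← Prod.fst_add, walk_translate, zero_add]
    simp [lagging, htranslate]
  · ext s
    simp [lagging]

theorem law_regen {v : ℝ} (hv : 0 < v) (p₀ p₁ : ℝ) (y : ℤ × ℤ) :
    law q ρ (regen p₀ p₁ v y) = law q ρ (regen p₀ p₁ v 0) := by
  have hS : MeasurableSet {e : (ℤ × ℤ → Prop) × (ℤ × ℤ → Prop) |
      e.2 0 ∧ ∀ i, walk e.1 0 i ∈ cone v 0} := by
    simp only [Set.ofPred_and, Set.ofPred_forall]
    exact .inter (measurableSet_setOfPred.2 (by fun_prop))
      (.iInter fun n => measurable_walk_of_fst 0 n .of_discrete)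
  convert! law_shift (q := q) (ρ := ρ) hv p₀ p₁ y hS using 2
  ext s
  have htranslate (n : ℕ) : walk (dir p₀ p₁ s) y n ∈ cone v y ↔
      walk (fun z => dir p₀ p₁ s (z + y)) 0 n ∈ cone v 0 := by
    rw [← cone_translate v y 0, walk_translate, zero_add]
  simp [regen, htranslate]

theorem law_diagonal (p₀ p₁ : ℝ) (K : ℕ) (y : ℤ × ℤ) :
    law q ρ (diagonal p₀ p₁ K y) = forceProb p₀ p₁ ^ K := by
  have hinj : Function.Injective fun l => y + diag l := fun l l' h => by simpa [diag] using h
  have hbox : diagonal p₀ p₁ K y = {s | s.2.2 ∈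
      (((Finset.range K).map ⟨_, hinj⟩ : Finset (ℤ × ℤ)) : Set (ℤ × ℤ)).pi
        fun _ => {u : unitInterval | (u : ℝ) ≤ min p₀ p₁}} := by
    ext s
    simp [diagonal]
  rw [hbox, law_uniform (.pi (Finset.countable_toSet _) fun _ _ => measurableSet_force p₀ p₁),
    Measure.infinitePi_pi _ fun _ _ => measurableSet_force p₀ p₁, Finset.prod_const,
    Finset.card_map, Finset.card_range, forceProb]

theorem law_diagonal_inter (p₀ p₁ : ℝ) {K : ℕ} {y : ℤ × ℤ} {A : Set (ℤ → ℤ)} {Z : Set (ℤ × ℤ)}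
    (hZ : ∀ l < K, y + diag l ∉ Z) {E : Set Sample} (hE : MeasurableSet[observed q ρ A Z] E) :
    law q ρ (diagonal p₀ p₁ K y ∩ E) = forceProb p₀ p₁ ^ K * law q ρ E := by
  have hindep := (Indep_iff _ _ (law q ρ)).1
    (indep_observed (Set.empty_disjoint A) (disjoint_compl_left (a := Z)))
  rw [hindep _ _ (measurableSet_diagonal p₀ p₁ hZ) hE, law_diagonal]

theorem measurableSet_freshRegen {v : ℝ} (hv : 0 < v) (p₀ p₁ : ℝ) (K : ℕ) (y : ℤ × ℤ) :
    MeasurableSet[observed q ρ (meeting (backCone v y))ᶜ (cone v (y + diag K))]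
      (freshRegen p₀ p₁ v K y) := by
  refine .inter (measurableSet_observed_void
    ((measurableSet_link _ _ _).diff (measurableSet_meeting _)) (fun w hw => hw.2)
    (measure_ne_top_of_subset Set.sdiff_subset (intensity_link hv le_rfl))) ?_
  rw [Set.ofPred_forall]
  exact .iInter fun i =>
    measurable_walk_dirOn p₀ p₁ (measurableSet_meeting _).compl _ _ i .of_discrete

/-- Particles that met the past of `y` are independent of those that did not, and the forced steps
use only the uniform variables along the diagonal, so the probability factorizes. -/
theorem le_law_past_inter {v : ℝ} (hv : 0 < v) (hv1 : v ≤ 1) (p₀ p₁ : ℝ) (K : ℕ) (y : ℤ × ℤ)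
    {E : Set Sample} (hE : MeasurableSet[observed q ρ (meeting (backCone v y)) (backCone v y)] E) :
    law q ρ E * (forceProb p₀ p₁ ^ K * law q ρ (regen p₀ p₁ v 0)) ≤
      law q ρ (E ∩ (diagonal p₀ p₁ K y ∩ freshRegen p₀ p₁ v K y)) := by
  have hdisj := disjoint_cone_backCone hv.le y
  have hcone : cone v (y + diag K) ⊆ (backCone v y)ᶜ :=
    (cone_subset hv.le (add_diag_mem_cone hv.le hv1 y K)).trans hdisj.subset_compl_right
  have hdiag (l : ℕ) : y + diag l ∈ (backCone v y)ᶜ :=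
    hdisj.subset_compl_right (add_diag_mem_cone hv.le hv1 y l)
  have hbelow : ∀ l < K, y + diag l ∉ cone v (y + diag K) := fun l hl hmem => by
    have htime := ((mem_cone_iff hv.le).1 hmem).1
    simp only [Prod.snd_add, diag_snd] at htime
    omega
  have hfresh := measurableSet_freshRegen (q := q) (ρ := ρ) hv p₀ p₁ K y
  have hindep := (Indep_iff _ _ (law q ρ)).1 (indep_observed
    (disjoint_compl_right (a := meeting (backCone v y))) (disjoint_compl_right (a := backCone v y)))
  rw [hindep _ _ hE ((measurableSet_diagonal p₀ p₁ fun l _ => hdiag l).inter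
      (observed_mono subset_rfl hcone _ hfresh)),
    law_diagonal_inter p₀ p₁ hbelow hfresh, ← law_regen hv p₀ p₁ (y + diag K)]
  gcongr
  exact regen_subset_freshRegen hv.le hv1 K y

theorem law_lagging_le {p₀ p₁ vstar c₀ γ : ℝ} (hball : BallisticityBound p₀ p₁ q ρ vstar c₀ γ)
    {L : ℕ} (hL : 1 ≤ L) (y : ℤ × ℤ) :
    law q ρ (lagging p₀ p₁ vstar L y) ≤
      ENNReal.ofReal (c₀⁻¹ * Real.exp (-c₀ * Real.log L ^ γ)) := by
  rw [law_lagging]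
  refine le_trans (le_of_eq ?_) (hball L hL)
  simp only [lagging, X, Y_eq_walk, Prod.fst_zero, Int.cast_zero, sub_zero]
  rfl

/-- Moving first to the right along the diagonal keeps the walk in the cone at `y` even if it lags
behind by `L` afterwards. -/
theorem le_law_regen {p₀ p₁ v vstar : ℝ} (hv : 0 < v) (hv1 : v ≤ 1) (hvstar : v ≤ vstar)
    {K L : ℕ} (hK : L ≤ (1 - v) * K) (y : ℤ × ℤ) :
    forceProb p₀ p₁ ^ K * (law q ρ (void (link v y y)) -
      law q ρ (lagging p₀ p₁ vstar L (y + diag K))) ≤ law q ρ (regen p₀ p₁ v y) := by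
  set Z : Set (ℤ × ℤ) := {z | (y + diag K).2 ≤ z.2}
  set E : Set Sample := void (link v y y) ∩
    {s | ∀ n, walk (dir p₀ p₁ s) (y + diag K) n ∈ cone v y}
  have hmeas : MeasurableSet[observed q ρ Set.univ Z] E := by
    refine .inter (measurableSet_observed_void (measurableSet_link _ _ _) (Set.subset_univ _)
      (intensity_link hv le_rfl)) ?_
    simp only [Set.ofPred_forall, ← walk_dirOn_univ]
    exact .iInter fun i => measurable_walk_dirOn p₀ p₁ .univ _ _ i .of_discrete
  have hlagging : void (link v y y) \ lagging p₀ p₁ vstar L (y + diag K) ⊆ E := fun s hs =>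
    ⟨hs.1, walk_mem_cone_of_notMem_lagging hv.le hvstar (by simp)
      (by rw [level_add, level_diag]; linarith) hs.2⟩
  calc forceProb p₀ p₁ ^ K * (law q ρ (void (link v y y)) -
        law q ρ (lagging p₀ p₁ vstar L (y + diag K)))
      ≤ forceProb p₀ p₁ ^ K * law q ρ E := by
        gcongr
        exact le_measure_sdiff.trans (measure_mono hlagging)
    _ = law q ρ (diagonal p₀ p₁ K y ∩ E) :=
        (law_diagonal_inter p₀ p₁ (fun l hl hmem => by simp [Z] at hmem; omega) hmeas).symm
    _ ≤ law q ρ (regen p₀ p₁ v y) :=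
        measure_mono (diagonal_inter_subset_regen hv.le hv1 K y)

theorem law_regen_ne_zero {p₀ p₁ v vstar c₀ γ : ℝ} (hp : forceProb p₀ p₁ ≠ 0) (hv : 0 < v)
    (hv1 : v < 1) (hvstar : v ≤ vstar) (hc₀ : 0 < c₀) (hγ : 0 < γ)
    (hball : BallisticityBound p₀ p₁ q ρ vstar c₀ γ) (y : ℤ × ℤ) :
    law q ρ (regen p₀ p₁ v y) ≠ 0 := by
  have hvoid : 0 < law q ρ (void (link v y y)) := by
    rw [law_void (measurableSet_link _ _ _) (intensity_link hv le_rfl)]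
    exact ENNReal.ofReal_pos.2 (Real.exp_pos _)
  have htail := ENNReal.tendsto_ofReal (tendsto_exp_neg_log_rpow hc₀ hγ)
  rw [ENNReal.ofReal_zero] at htail
  obtain ⟨L, hLlt, hL⟩ := ((htail.eventually_lt_const hvoid).and (eventually_ge_atTop 1)).exists
  obtain ⟨K, hK⟩ := exists_nat_ge (L / (1 - v))
  rw [div_le_iff₀' (sub_pos.2 hv1)] at hK
  refine (lt_of_lt_of_le ?_ (le_law_regen hv hv1.le hvstar hK y)).ne'
  exact ENNReal.mul_pos (pow_ne_zero _ hp)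
    (tsub_pos_of_lt ((law_lagging_le hball hL _).trans_lt hLlt)).ne'

end Law

/-- `n` is the first time at which the level of the path `w` is at least `(1 - v) k`. -/
def IsRecord (v : ℝ) (w : ℕ → ℤ × ℤ) (k n : ℕ) : Prop :=
  (1 - v) * k ≤ level v (w n) ∧ ∀ m < n, level v (w m) < (1 - v) * k

/-- After the record `k` the path makes `K` steps to the right, arrives at a point where `c` holds,
and stays in the cone of that point until the record `k'`. -/
def Succeeds (v : ℝ) (K : ℕ) (w : ℕ → ℤ × ℤ) (c : ℤ × ℤ → Prop) (k k' : ℕ) : Prop :=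
  ∃ n N, IsRecord v w k n ∧ IsRecord v w k' N ∧ n + K < N ∧
    (∀ l ≤ K, w (n + l) = w n + diag l) ∧ c (w (n + K)) ∧
    ∀ m, n + K ≤ m → m ≤ N → w m ∈ cone v (w (n + K))

section Records

variable {v : ℝ} {w w' : ℕ → ℤ × ℤ} {k k' n n' K : ℕ}

theorem IsRecord.unique (h : IsRecord v w k n) (h' : IsRecord v w k n') : n = n' :=
  le_antisymm (not_lt.1 fun hlt => (h.2 n' hlt).not_ge h'.1)
    (not_lt.1 fun hlt => (h'.2 n hlt).not_ge h.1)

theorem exists_isRecord (h : (1 - v) * k ≤ level v (w n)) : ∃ m ≤ n, IsRecord v w k m := by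
  classical
  have hex : ∃ n, (1 - v) * k ≤ level v (w n) := ⟨n, h⟩
  exact ⟨Nat.find hex, Nat.find_min' hex h, Nat.find_spec hex,
    fun m hm => not_le.1 (Nat.find_min hex hm)⟩

theorem IsRecord.le (hv1 : v ≤ 1) (hk : k ≤ k') (h : IsRecord v w k n)
    (h' : IsRecord v w k' n') : n ≤ n' := by
  have hthreshold : (1 - v) * k ≤ (1 - v) * k' :=
    mul_le_mul_of_nonneg_left (by exact_mod_cast hk) (sub_nonneg.2 hv1)
  exact not_lt.1 fun hlt => (h.2 n' hlt).not_ge (hthreshold.trans h'.1)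

theorem IsRecord.congr (hw : ∀ m ≤ n, w' m = w m) (h : IsRecord v w k n) : IsRecord v w' k n :=
  ⟨by rw [hw n le_rfl]; exact h.1, fun m hm => by rw [hw m hm.le]; exact h.2 m hm⟩

theorem Succeeds.congr (hv1 : v ≤ 1) {c c' : ℤ × ℤ → Prop} {j : ℕ} (hj : IsRecord v w j n)
    (hk : k' ≤ j) (hw : ∀ m ≤ n, w' m = w m) (hc : ∀ m < n, c (w m) → c' (w m))
    (h : Succeeds v K w c k k') : Succeeds v K w' c' k k' := by
  obtain ⟨m, N, hm, hN, hlt, hdiag, hpoint, hcone⟩ := h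
  have hNn : N ≤ n := hN.le hv1 hk hj
  refine ⟨m, N, hm.congr fun i hi => hw i (by omega), hN.congr fun i hi => hw i (by omega), hlt,
    fun l hl => ?_, ?_, fun i hi hiN => ?_⟩
  · rw [hw _ (by omega), hw _ (by omega), hdiag l hl]
  · rw [hw _ (by omega)]
    exact hc _ (by omega) hpoint
  · rw [hw _ (by omega), hw _ (by omega)]
    exact hcone i hi hiN

variable {d : ℤ × ℤ → Prop}

theorem IsRecord.level_lt (hv1 : v < 1) (h : IsRecord v (walk d 0) k n) :
    level v (walk d 0 n) < (1 - v) * (k + 1) := by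
  rcases n with _ | n
  · simpa [level] using mul_pos (sub_pos.2 hv1) (Nat.cast_add_one_pos (α := ℝ) k)
  · have hbefore := h.2 n n.lt_succ_self
    have hstep := level_walk_succ_le v d 0 n
    linarith

theorem IsRecord.add_lt (hv1 : v < 1) (hk : k + K + 1 ≤ k') (h : IsRecord v (walk d 0) k n)
    (h' : IsRecord v (walk d 0) k' n') : n + K < n' := by
  obtain ⟨m, rfl⟩ := Nat.exists_eq_add_of_le (h.le hv1.le (by omega) h')
  have hgap : (1 - v) * (k + K + 1) ≤ (1 - v) * k' :=
    mul_le_mul_of_nonneg_left (by exact_mod_cast hk) (sub_nonneg.2 hv1.le)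
  have hspeed : (1 - v) * K < (1 - v) * m := by
    linarith [h.level_lt hv1, h'.1, level_walk_add_le v d 0 n m]
  have hKm : K < m := by exact_mod_cast lt_of_mul_lt_mul_left hspeed (sub_nonneg.2 hv1.le)
  omega

theorem IsRecord.mem_backCone (hv : 0 ≤ v) {m : ℕ} (h : IsRecord v (walk d 0) k n) (hm : m < n) :
    walk d 0 m ∈ backCone v (walk d 0 n) := by
  rw [mem_backCone_iff hv, walk_snd, walk_snd]
  exact ⟨by omega, (h.2 m hm).trans_le h.1⟩

theorem IsRecord.add_diagonal (hv1 : v < 1) (h : IsRecord v (walk d 0) k n)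
    (hK : ∀ l ≤ K, walk d 0 (n + l) = walk d 0 n + diag l) :
    IsRecord v (walk d 0) (k + K) (n + K) := by
  have hlevel (l : ℕ) (hl : l ≤ K) :
      level v (walk d 0 (n + l)) = level v (walk d 0 n) + (1 - v) * l := by
    rw [hK l hl, level_add, level_diag]
  have hpos : 0 < 1 - v := sub_pos.2 hv1
  rw [IsRecord, hlevel K le_rfl, Nat.cast_add, mul_add]
  refine ⟨add_le_add_left h.1 _, fun m hm => ?_⟩
  rcases lt_or_ge m n with hmn | hnm
  · exact (h.2 m hmn).trans_le (le_add_of_nonneg_right (by positivity))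
  · obtain ⟨l, rfl⟩ := Nat.exists_eq_add_of_le hnm
    rw [hlevel l (by omega)]
    have hlK : (1 - v) * (l + 1) ≤ (1 - v) * K :=
      mul_le_mul_of_nonneg_left (by exact_mod_cast (by omega : l + 1 ≤ K)) hpos.le
    linarith [h.level_lt hv1]

end Records

/-- The box of space-time points that the walk from the origin can visit up to time `T`. -/
noncomputable def box (T : ℕ) : Finset (ℤ × ℤ) := Finset.Icc (-T : ℤ) T ×ˢ Finset.Icc (0 : ℤ) T

theorem card_box (T : ℕ) : (box T).card = (2 * T + 1) * (T + 1) := by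
  rw [box, Finset.card_product, Int.card_Icc, Int.card_Icc]
  congr 1
  omega

theorem walk_sub_mem_box {d : ℤ × ℤ → Prop} {n T : ℕ} (y : ℤ × ℤ) (h : n ≤ T) :
    walk d y n - y ∈ box T := by
  have hfst := abs_le.1 (abs_walk_fst_sub_le d y n)
  have hsnd := walk_snd d y n
  simp only [box, Finset.mem_product, Finset.mem_Icc, Prod.fst_sub, Prod.snd_sub]
  omega

theorem walk_mem_box {d : ℤ × ℤ → Prop} {n T : ℕ} (h : n ≤ T) : walk d 0 n ∈ box T := by
  simpa using walk_sub_mem_box (d := d) 0 h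

/-- No walk started in the box lags behind speed `3 v`, and no particle links points of the box
whose levels differ by at least `L`. -/
def typical (p₀ p₁ v : ℝ) (L T : ℕ) : Set Sample :=
  {s | (∀ z ∈ box T, s ∉ lagging p₀ p₁ (3 * v) L z) ∧
    ∀ y ∈ box T, ∀ z ∈ box T, y.2 ≤ z.2 → (L : ℝ) ≤ level v z - level v y → s ∈ void (link v y z)}

/-- The walk from the origin. -/
noncomputable abbrev originWalk (p₀ p₁ : ℝ) (s : Sample) : ℕ → ℤ × ℤ := walk (dir p₀ p₁ s) 0

theorem record_le_X_iff {p₀ p₁ v : ℝ} {s : Sample} {k n : ℕ} :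
    (1 - v) * k + v * n ≤ (X p₀ p₁ s n : ℝ) ↔
      (1 - v) * k ≤ level v (originWalk p₀ p₁ s n) := by
  rw [← le_sub_iff_add_le, X, Y_eq_walk, level, walk_snd, Prod.snd_zero, zero_add,
    Int.cast_natCast, Prod.mk_zero_zero]

theorem recordTime_eq {p₀ p₁ v : ℝ} {s : Sample} {k n : ℕ}
    (h : IsRecord v (originWalk p₀ p₁ s) k n) : recordTime p₀ p₁ v s k = n := by
  refine le_antisymm (sInf_le ⟨n, rfl, record_le_X_iff.2 h.1⟩) (le_sInf ?_)
  rintro _ ⟨m, rfl, hm⟩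
  exact Nat.cast_le.2 (not_lt.1 fun hlt => (h.2 m hlt).not_ge (record_le_X_iff.1 hm))

theorem recordTime_mono {p₀ p₁ v : ℝ} (hv1 : v ≤ 1) (s : Sample) :
    Monotone (recordTime p₀ p₁ v s) := by
  intro k k' hk
  refine sInf_le_sInf ?_
  rintro _ ⟨n, rfl, hn⟩
  refine ⟨n, rfl, le_trans ?_ hn⟩
  have := sub_nonneg.2 hv1
  gcongr

theorem regenerationTime_le {p₀ p₁ v : ℝ} (hv1 : v ≤ 1) {s : Sample} {k n : ℕ} (hk : 1 ≤ k)
    (h : IsRecord v (originWalk p₀ p₁ s) k n) (hr : s ∈ regen p₀ p₁ v (originWalk p₀ p₁ s n)) :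
    regenerationTime p₀ p₁ v s ≤ n := by
  have hindex : regenerationIndex p₀ p₁ v s ≤ k := by
    refine sInf_le ⟨k, n, rfl, hk, recordTime_eq h, ?_⟩
    rw [Y_eq_walk]
    exact regenerates_of_mem_regen hr
  obtain ⟨k₀, hk₀⟩ := ENat.ne_top_iff_exists.1 (hindex.trans_lt (ENat.natCast_lt_top k)).ne
  have htime : regenerationTime p₀ p₁ v s = recordTime p₀ p₁ v s k₀ := by
    rw [regenerationTime, ← hk₀]
  rw [htime, ← recordTime_eq h]
  exact recordTime_mono hv1 s (Nat.cast_le.1 (hk₀.trans_le hindex))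

section Typical

variable {p₀ p₁ v : ℝ} {L T : ℕ} {s : Sample}

theorem level_le_of_typical (hs : s ∈ typical p₀ p₁ v L T) {n : ℕ} (hn : n ≤ T) (m : ℕ) :
    level v (originWalk p₀ p₁ s n) + 2 * v * m - L ≤ level v (originWalk p₀ p₁ s (n + m)) := by
  have hfst := le_walk_fst_of_notMem_lagging (hs.1 _ (walk_mem_box (d := dir p₀ p₁ s) hn)) m
  rw [originWalk, walk_add]
  simp only [level, walk_snd, Int.cast_add, Int.cast_natCast] at hfst ⊢
  linarith

theorem exists_isRecord_of_typical (hv : 0 ≤ v) (hs : s ∈ typical p₀ p₁ v L T) {k : ℕ}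
    (hk : (L : ℝ) + k ≤ 2 * v * T) : ∃ n ≤ T, IsRecord v (originWalk p₀ p₁ s) k n := by
  refine exists_isRecord ?_
  have hlevel := level_le_of_typical hs (Nat.zero_le T) T
  have hvk : 0 ≤ v * k := by positivity
  rw [zero_add, originWalk, walk_zero, level, Prod.fst_zero, Prod.snd_zero, Int.cast_zero] at hlevel
  linarith

theorem isRecord_le_of_typical (hv : 0 ≤ v) (hs : s ∈ typical p₀ p₁ v L T) {k k' n n' M : ℕ}
    (hn : n ≤ T) (h : IsRecord v (originWalk p₀ p₁ s) k n)
    (h' : IsRecord v (originWalk p₀ p₁ s) k' n') (hkk : k ≤ k')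
    (hk : (L : ℝ) + k' ≤ k + 2 * v * M) : n' ≤ n + M := by
  have hlevel := level_le_of_typical hs hn M
  have hvk : v * k ≤ v * k' := by gcongr
  obtain ⟨m, hm, hrecord⟩ := exists_isRecord (k := k') (show _ ≤ level v _ by linarith [h.1])
  exact (h'.unique hrecord).trans_le hm

/-- Between the records `k + K` and `k + 3 L` the walk gains more than `L` levels, and in a typical
environment it never loses more than `L` levels afterwards. -/
theorem walk_mem_cone_of_typical (hv : 0 ≤ v) (hv3 : v ≤ 1 / 3) (hs : s ∈ typical p₀ p₁ v L T)
    {k n N K : ℕ} (hn : IsRecord v (originWalk p₀ p₁ s) (k + K) n)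
    (hN : IsRecord v (originWalk p₀ p₁ s) (k + 3 * L) N) (hNT : N ≤ T) (hKL : K + 1 ≤ L) {i : ℕ}
    (hni : n ≤ i) (hNi : N ≤ i) : originWalk p₀ p₁ s i ∈ cone v (originWalk p₀ p₁ s n) := by
  obtain ⟨m, rfl⟩ := Nat.exists_eq_add_of_le hNi
  rw [mem_cone_iff hv, walk_snd, walk_snd]
  refine ⟨by omega, ?_⟩
  have hlevel := level_le_of_typical hs hNT m
  have hstart := hn.level_lt (by linarith)
  have hend := hN.1
  have hKL' : (K : ℝ) + 1 ≤ L := by exact_mod_cast hKL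
  have hvm : 0 ≤ 2 * v * m := by positivity
  push_cast at hstart hend
  nlinarith

theorem regenerationTime_le_of_succeeds (hv : 0 ≤ v) (hv3 : v ≤ 1 / 3)
    (hs : s ∈ typical p₀ p₁ v L T) {K k : ℕ} (hK : 1 ≤ K) (hKL : K + 1 ≤ L)
    (hk : (L : ℝ) + (k + 3 * L : ℕ) ≤ 2 * v * T)
    (h : Succeeds v K (originWalk p₀ p₁ s) (fun y => s ∈ void (link v y y)) k (k + 3 * L)) :
    regenerationTime p₀ p₁ v s ≤ T := by
  obtain ⟨n, N, hn, hN, hlt, hdiag, hvoid, hcone⟩ := h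
  obtain ⟨N', hN'T, hN'⟩ := exists_isRecord_of_typical hv hs hk
  have hNT : N ≤ T := (hN.unique hN').trans_le hN'T
  have hrecord := hn.add_diagonal (by linarith) hdiag
  have hregen : s ∈ regen p₀ p₁ v (originWalk p₀ p₁ s (n + K)) := by
    refine ⟨hvoid, fun i => ?_⟩
    rw [originWalk, ← walk_add]
    rcases le_total (n + K + i) N with hi | hi
    · exact hcone _ (by omega) hi
    · exact walk_mem_cone_of_typical hv hv3 hs hrecord hN hNT hKL (by omega) hi
  refine (regenerationTime_le (by linarith) (by omega) hrecord hregen).trans ?_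
  exact_mod_cast (by omega : n + K ≤ T)

end Typical

/-- The path `w` reaches the record `Δ j` at the point `y`, and all trials at the records `Δ i` with
`i < j` have failed for the field `c` of suitable points. -/
def FailedPath (v : ℝ) (K Δ j : ℕ) (w : ℕ → ℤ × ℤ) (c : ℤ × ℤ → Prop) (y : ℤ × ℤ) : Prop :=
  (∃ n, IsRecord v w (Δ * j) n ∧ w n = y) ∧
    ∀ i < j, ¬Succeeds v K w c (Δ * i) (Δ * (i + 1))

/-- The event that the walk reaches the record `Δ j` at the point `y` after `j` failed trials. -/
def failedAt (p₀ p₁ v : ℝ) (K Δ j : ℕ) (y : ℤ × ℤ) : Set Sample :=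
  {s | FailedPath v K Δ j (originWalk p₀ p₁ s) (fun z => s ∈ void (link v z z)) y}

/-- The event that the walk reaches the record `Δ j` after `j` failed trials. -/
def failed (p₀ p₁ v : ℝ) (K Δ j : ℕ) : Set Sample := ⋃ y, failedAt p₀ p₁ v K Δ j y

/-- The part of `failed` on which no particle links the past of the record point to the future
of the trial. -/
def unlinked (p₀ p₁ v : ℝ) (K Δ j : ℕ) : Set Sample :=
  ⋃ y, failedAt p₀ p₁ v K Δ j y ∩ void (link v y (y + diag K))

/-- For some point `z` of the box at `y`, a particle that avoids the backward cone at `y` links the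
past of `z` to the future of a trial at `z`. -/
def freshLink (v : ℝ) (K M : ℕ) (y : ℤ × ℤ) : Set Sample :=
  ⋃ a ∈ box M, (void (link v (y + a) (y + a + diag K) \ meeting (backCone v y)))ᶜ

section Measurability

variable {Ω : Type*} [MeasurableSpace Ω] {w : Ω → ℕ → ℤ × ℤ} {c : Ω → ℤ × ℤ → Prop}

theorem measurable_isRecord (hw : ∀ n, Measurable fun ω => w ω n) (v : ℝ) (k n : ℕ) :
    Measurable fun ω => IsRecord v (w ω) k n := by
  have hlevel (m : ℕ) (P : ℝ → Prop) : Measurable fun ω => P (level v (w ω m)) :=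
    (Measurable.of_discrete (f := fun z => P (level v z))).comp (hw m)
  exact (hlevel n ((1 - v) * k ≤ ·)).and
    (.forall fun m => .imp measurable_const (hlevel m (· < (1 - v) * k)))

theorem measurable_succeeds (hw : ∀ n, Measurable fun ω => w ω n)
    (hc : ∀ z, MeasurableSet {ω | c ω z}) (v : ℝ) (K k k' : ℕ) :
    Measurable fun ω => Succeeds v K (w ω) (c ω) k k' := by
  have hpair (m m' : ℕ) (P : ℤ × ℤ → ℤ × ℤ → Prop) : Measurable fun ω => P (w ω m) (w ω m') :=
    (Measurable.of_discrete (f := fun z : (ℤ × ℤ) × (ℤ × ℤ) => P z.1 z.2)).comp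
      ((hw m).prodMk (hw m'))
  have hpoint (m : ℕ) : Measurable fun ω => c ω (w ω m) := by
    have hunion : {ω | c ω (w ω m)} = ⋃ z, ((fun ω => w ω m) ⁻¹' {z} ∩ {ω | c ω z}) := by
      ext
      simp
    exact measurableSet_setOfPred.1
      (hunion ▸ .iUnion fun z => (hw m (measurableSet_singleton z)).inter (hc z))
  refine .exists fun n => .exists fun N => (measurable_isRecord hw v k n).and
    ((measurable_isRecord hw v k' N).and (measurable_const.and (.and ?_ ((hpoint _).and ?_))))
  · exact .forall fun l => .imp measurable_const (hpair (n + l) n fun a b => a = b + diag l)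
  · exact .forall fun m => .imp measurable_const (.imp measurable_const
      (hpair m (n + K) fun a b => a ∈ cone v b))

theorem measurable_failedPath (hw : ∀ n, Measurable fun ω => w ω n)
    (hc : ∀ z, MeasurableSet {ω | c ω z}) (v : ℝ) (K Δ j : ℕ) (y : ℤ × ℤ) :
    Measurable fun ω => FailedPath v K Δ j (w ω) (c ω) y :=
  (Measurable.exists fun n => (measurable_isRecord hw v _ n).and
      ((Measurable.of_discrete (f := fun z => z = y)).comp (hw n))).and
    (.forall fun _ => .imp measurable_const (measurable_succeeds hw hc v K _ _).not)

end Measurability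

section Failures

variable {p₀ p₁ v : ℝ} {K Δ j : ℕ} {y : ℤ × ℤ} {s : Sample}

theorem mem_failed_iff : s ∈ failed p₀ p₁ v K Δ j ↔
    (∃ n, IsRecord v (originWalk p₀ p₁ s) (Δ * j) n) ∧ ∀ i < j,
      ¬Succeeds v K (originWalk p₀ p₁ s) (fun z => s ∈ void (link v z z)) (Δ * i)
        (Δ * (i + 1)) := by
  simp only [failed, Set.mem_iUnion]
  exact ⟨fun ⟨_, ⟨n, hn, _⟩, hfail⟩ => ⟨⟨n, hn⟩, hfail⟩,
    fun ⟨⟨n, hn⟩, hfail⟩ => ⟨_, ⟨n, hn, rfl⟩, hfail⟩⟩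

theorem failedAt_pairwise_disjoint (p₀ p₁ v : ℝ) (K Δ j : ℕ) :
    Pairwise (Function.onFun Disjoint (failedAt p₀ p₁ v K Δ j)) := by
  refine fun y y' hne => Set.disjoint_left.2 ?_
  rintro s ⟨⟨n, hn, rfl⟩, -⟩ ⟨⟨n', hn', rfl⟩, -⟩
  exact hne (by rw [hn.unique hn'])

theorem failed_succ_subset (hv1 : v ≤ 1) :
    failed p₀ p₁ v K Δ (j + 1) ⊆ failed p₀ p₁ v K Δ j := by
  intro s hs
  rw [mem_failed_iff] at hs ⊢
  obtain ⟨⟨n, hn⟩, hfail⟩ := hs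
  refine ⟨?_, fun i hi => hfail i (by omega)⟩
  obtain ⟨m, -, hm⟩ := exists_isRecord (k := Δ * j) (hn.1.trans' (mul_le_mul_of_nonneg_left
    (by exact_mod_cast Nat.mul_le_mul_left Δ j.le_succ) (sub_nonneg.2 hv1)))
  exact ⟨m, hm⟩

theorem FailedPath.congr (hv : 0 ≤ v) (hv1 : v ≤ 1) {d d' c c' : ℤ × ℤ → Prop}
    (hd : ∀ z ∈ backCone v y, d z ↔ d' z) (hc : ∀ z ∈ backCone v y, c' z → c z)
    (h : FailedPath v K Δ j (walk d 0) c y) : FailedPath v K Δ j (walk d' 0) c' y := by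
  obtain ⟨⟨n, hn, rfl⟩, hfail⟩ := h
  have hwalk : ∀ m ≤ n, walk d' 0 m = walk d 0 m := fun m hm =>
    walk_congr fun i hi => hd _ (hn.mem_backCone hv (by omega))
  have hn' := hn.congr hwalk
  refine ⟨⟨n, hn', hwalk n le_rfl⟩, fun i hi hsucc => hfail i hi ?_⟩
  refine hsucc.congr hv1 hn' (Nat.mul_le_mul_left _ hi) (fun m hm => (hwalk m hm).symm)
    fun m hm => ?_
  rw [hwalk m hm.le]
  exact hc _ (hn.mem_backCone hv hm)

theorem mem_failedAt_iff (hv : 0 ≤ v) (hv1 : v ≤ 1) : s ∈ failedAt p₀ p₁ v K Δ j y ↔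
    FailedPath v K Δ j (walk (dirOn p₀ p₁ (meeting (backCone v y)) (backCone v y) s) 0)
      (fun z => z ∈ backCone v y ∧ s ∈ void (link v z z)) y := by
  have hdir : ∀ z ∈ backCone v y,
      dirOn p₀ p₁ (meeting (backCone v y)) (backCone v y) s z ↔ dir p₀ p₁ s z := by
    refine fun z hz => dirOn_iff_dir hz ?_
    rw [Set.sdiff_eq_empty.2 (through_subset_meeting hz), void_empty]
    trivial
  exact ⟨.congr hv hv1 (fun z hz => (hdir z hz).symm) fun z _ => And.right,
    .congr hv hv1 hdir fun z hz => And.intro hz⟩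

theorem notMem_failed_succ (hv1 : v < 1) (hKΔ : K + 1 ≤ Δ) (hs : s ∈ failedAt p₀ p₁ v K Δ j y)
    (hdiag : s ∈ diagonal p₀ p₁ K y) (hregen : s ∈ regen p₀ p₁ v (y + diag K)) :
    s ∉ failed p₀ p₁ v K Δ (j + 1) := by
  rw [mem_failed_iff]
  rintro ⟨⟨N, hN⟩, hfail⟩
  obtain ⟨⟨n, hn, rfl⟩, -⟩ := hs
  have hsteps : ∀ l ≤ K, originWalk p₀ p₁ s (n + l) = originWalk p₀ p₁ s n + diag l :=
    fun l hl => (walk_add _ _ _ _).trans (walk_of_mem_diagonal hdiag hl)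
  rw [← hsteps K le_rfl] at hregen
  refine hfail j j.lt_succ_self ⟨n, N, hn, hN, hn.add_lt hv1 ?_ hN, hsteps, hregen.1, ?_⟩
  · rw [mul_add, mul_one]
    omega
  · rintro m hm -
    obtain ⟨i, rfl⟩ := Nat.exists_eq_add_of_le hm
    have hstay := hregen.2 i
    rwa [← walk_add] at hstay

variable {L T M : ℕ}

theorem mem_void_link_of_typical (hv1 : v < 1) (hs : s ∈ typical p₀ p₁ v L T) {k k' n N : ℕ}
    (hNT : N ≤ T) (hn : IsRecord v (originWalk p₀ p₁ s) k n)
    (hN : IsRecord v (originWalk p₀ p₁ s) k' N) (hnN : n ≤ N)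
    (hgap : L + (1 - v) * (k + 1) ≤ (1 - v) * k') :
    s ∈ void (link v (originWalk p₀ p₁ s n) (originWalk p₀ p₁ s N)) := by
  refine hs.2 _ (walk_mem_box (hnN.trans hNT)) _ (walk_mem_box hNT) ?_ ?_
  · rw [walk_snd, walk_snd]
    omega
  · linarith [hN.1, hn.level_lt hv1]

theorem failed_diff_unlinked_subset (hv : 0 ≤ v) (hv3 : v ≤ 1 / 3) (hL : 1 ≤ L)
    (hT : (L : ℝ) + (3 * L * (j + 1) : ℕ) ≤ 2 * v * T) (hM : 2 * (L : ℝ) ≤ v * M) :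
    failed p₀ p₁ v K (3 * L) (j + 1) \ unlinked p₀ p₁ v K (3 * L) (j + 1) ⊆
      (typical p₀ p₁ v L T)ᶜ ∪ ⋃ y, failedAt p₀ p₁ v K (3 * L) j y ∩ freshLink v K M y := by
  rintro s ⟨hs, hunlinked⟩
  refine or_iff_not_imp_left.2 fun htypical => ?_
  rw [Set.mem_compl_iff, not_not] at htypical
  obtain ⟨⟨n, hn⟩, hfail⟩ := mem_failed_iff.1 (failed_succ_subset (by linarith) hs)
  obtain ⟨⟨N, hN⟩, hfail'⟩ := mem_failed_iff.1 hs
  have hNT : N ≤ T := by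
    obtain ⟨N', hN'T, hN'⟩ := exists_isRecord_of_typical hv htypical hT
    exact (hN.unique hN').trans_le hN'T
  have hrecords : 3 * L * j ≤ 3 * L * (j + 1) := Nat.mul_le_mul_left _ j.le_succ
  have hnN : n ≤ N := hn.le (by linarith) hrecords hN
  have hNM : N ≤ n + M :=
    isRecord_le_of_typical hv htypical (hnN.trans hNT) hn hN hrecords (by push_cast; linarith)
  have hlink : s ∈ void (link v (originWalk p₀ p₁ s n) (originWalk p₀ p₁ s N)) := by
    have hL1 : (1 : ℝ) ≤ L := by exact_mod_cast hL
    exact mem_void_link_of_typical (by linarith) htypical hNT hn hN hnN (by push_cast; nlinarith)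
  refine Set.mem_iUnion.2 ⟨originWalk p₀ p₁ s n, ⟨⟨n, hn, rfl⟩, hfail⟩, ?_⟩
  obtain ⟨m, rfl⟩ := Nat.exists_eq_add_of_le hnN
  refine Set.mem_biUnion (x := originWalk p₀ p₁ s (n + m) - originWalk p₀ p₁ s n) ?_ ?_
  · rw [originWalk, walk_add]
    exact walk_sub_mem_box _ (by omega)
  rw [add_sub_cancel]
  intro hfresh
  refine hunlinked (Set.mem_iUnion.2 ⟨_, ⟨⟨_, hN, rfl⟩, hfail'⟩, void_anti (link_subset_union
    (cone_subset hv (add_diag_mem_cone hv (by linarith) _ K)) (originWalk p₀ p₁ s n)) ?_⟩)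
  exact void_union _ _ ▸ ⟨hfresh, hlink⟩

theorem regenerationTime_gt_subset (hv : 0 ≤ v) (hv3 : v ≤ 1 / 3) (hK : 1 ≤ K) (hKL : K + 1 ≤ L)
    (hT : (L : ℝ) + (3 * L * (j + 1) : ℕ) ≤ 2 * v * T) :
    {s | (T : ℕ∞) < regenerationTime p₀ p₁ v s} ⊆
      (typical p₀ p₁ v L T)ᶜ ∪ failed p₀ p₁ v K (3 * L) (j + 1) := by
  refine fun s hs => or_iff_not_imp_left.2 fun htypical => ?_
  rw [Set.mem_compl_iff, not_not] at htypical
  obtain ⟨N, -, hN⟩ := exists_isRecord_of_typical hv htypical hT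
  refine mem_failed_iff.2 ⟨⟨N, hN⟩, fun i hi hsucc => (Set.mem_ofPred_eq ▸ hs).not_ge ?_⟩
  have hend : 3 * L * (i + 1) = 3 * L * i + 3 * L := by ring
  rw [hend] at hsucc
  refine regenerationTime_le_of_succeeds hv hv3 htypical hK hKL (hT.trans' ?_) hsucc
  rw [← hend]
  have hij : 3 * L * (i + 1) ≤ 3 * L * (j + 1) := Nat.mul_le_mul_left _ hi
  gcongr

end Failures

section Law

variable {q : ℝ} [IsProbabilityMeasure (lazyStep q)] {ρ : ℝ≥0} {p₀ p₁ v : ℝ}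

theorem measurableSet_observed_failedAt (hv : 0 < v) (hv1 : v ≤ 1) (p₀ p₁ : ℝ) (K Δ j : ℕ)
    (y : ℤ × ℤ) :
    MeasurableSet[observed q ρ (meeting (backCone v y)) (backCone v y)]
      (failedAt p₀ p₁ v K Δ j y) := by
  have hvoid (z : ℤ × ℤ) : MeasurableSet[observed q ρ (meeting (backCone v y)) (backCone v y)]
      {s | z ∈ backCone v y ∧ s ∈ void (link v z z)} := by
    by_cases hz : z ∈ backCone v y
    · simp only [hz, true_and]
      exact measurableSet_observed_void (measurableSet_link _ _ _)
        (fun w hw => meeting_mono (backCone_subset_of_mem hv.le hz) hw.1)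
        (intensity_link hv le_rfl)
    · simp [hz]
  have hpath : failedAt p₀ p₁ v K Δ j y = {s | _} := Set.ext fun s => mem_failedAt_iff hv.le hv1
  rw [hpath]
  let _ := observed q ρ (meeting (backCone v y)) (backCone v y)
  exact measurableSet_setOfPred.2 (measurable_failedPath
    (measurable_walk_dirOn p₀ p₁ (measurableSet_meeting _) (backCone v y) 0) hvoid v K Δ j y)

theorem law_unlinked_mul_le (hv : 0 < v) (hv1 : v < 1) (p₀ p₁ : ℝ) {K Δ : ℕ} (hKΔ : K + 1 ≤ Δ)
    (j : ℕ) :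
    law q ρ (unlinked p₀ p₁ v K Δ j) * (forceProb p₀ p₁ ^ K * law q ρ (regen p₀ p₁ v 0)) ≤
      law q ρ (failed p₀ p₁ v K Δ j \ failed p₀ p₁ v K Δ (j + 1)) := by
  set past : ℤ × ℤ → Set Sample :=
    fun y => failedAt p₀ p₁ v K Δ j y ∩ void (link v y (y + diag K))
  set future : ℤ × ℤ → Set Sample := fun y => diagonal p₀ p₁ K y ∩ freshRegen p₀ p₁ v K y
  have hpast (y : ℤ × ℤ) :
      MeasurableSet[observed q ρ (meeting (backCone v y)) (backCone v y)] (past y) :=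
    .inter (measurableSet_observed_failedAt hv hv1.le p₀ p₁ K Δ j y)
      (measurableSet_observed_void (measurableSet_link _ _ _) Set.inter_subset_left
        (intensity_link hv (by simp)))
  have hfuture (y : ℤ × ℤ) : MeasurableSet (future y) :=
    (observed_le (q := q) (ρ := ρ) _ (measurableSet_diagonal (A := ∅) (Z := Set.univ) p₀ p₁
      fun _ _ => trivial)).inter
      (observed_le (q := q) (ρ := ρ) _ (measurableSet_freshRegen hv p₀ p₁ K y))
  have hdisj : Pairwise (Function.onFun Disjoint fun y => past y ∩ future y) := fun y y' hne =>
    (failedAt_pairwise_disjoint p₀ p₁ v K Δ j hne).mono (fun _ hs => hs.1.1) fun _ hs => hs.1.1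
  have hsub : ⋃ y, past y ∩ future y ⊆ failed p₀ p₁ v K Δ j \ failed p₀ p₁ v K Δ (j + 1) :=
    Set.iUnion_subset fun y _ ⟨⟨hfailed, hlink⟩, hdiag, hfresh⟩ =>
      ⟨Set.mem_iUnion.2 ⟨y, hfailed⟩, notMem_failed_succ hv1 hKΔ hfailed hdiag
        (freshRegen_inter_subset_regen p₀ p₁ v K y ⟨hfresh, hlink⟩)⟩
  calc law q ρ (⋃ y, past y) * (forceProb p₀ p₁ ^ K * law q ρ (regen p₀ p₁ v 0))
      ≤ ∑' y, law q ρ (past y) * (forceProb p₀ p₁ ^ K * law q ρ (regen p₀ p₁ v 0)) := by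
        rw [ENNReal.tsum_mul_right]
        gcongr
        exact measure_iUnion_le past
    _ ≤ ∑' y, law q ρ (past y ∩ future y) :=
        ENNReal.tsum_le_tsum fun y => le_law_past_inter hv hv1.le p₀ p₁ K y (hpast y)
    _ ≤ law q ρ (⋃ y, past y ∩ future y) :=
        tsum_meas_le_meas_iUnion_of_disjoint _
          (fun y => (observed_le _ (hpast y)).inter (hfuture y)) hdisj
    _ ≤ _ := measure_mono hsub

theorem law_failed_succ_le (hv : 0 < v) (hv1 : v < 1) (p₀ p₁ : ℝ) {K Δ : ℕ} (hKΔ : K + 1 ≤ Δ)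
    (j : ℕ) :
    law q ρ (failed p₀ p₁ v K Δ (j + 1)) + law q ρ (unlinked p₀ p₁ v K Δ j) *
      (forceProb p₀ p₁ ^ K * law q ρ (regen p₀ p₁ v 0)) ≤ law q ρ (failed p₀ p₁ v K Δ j) := by
  have hmeas : MeasurableSet (failed p₀ p₁ v K Δ (j + 1)) := .iUnion fun y =>
    observed_le _ (measurableSet_observed_failedAt (q := q) (ρ := ρ) hv hv1.le p₀ p₁ K Δ _ y)
  rw [← measure_inter_add_sdiff (failed p₀ p₁ v K Δ j) hmeas,
    Set.inter_eq_right.2 (failed_succ_subset hv1.le)]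
  gcongr
  exact law_unlinked_mul_le hv hv1 p₀ p₁ hKΔ j

theorem law_freshLink_le {C : ℝ} (hC : ∀ y z : ℤ × ℤ, y.2 ≤ z.2 → intensity q ρ (link v y z) ≤
      ENNReal.ofReal (C * Real.exp (-(v * (level v z - level v y) / 2)))) (K M : ℕ) (y : ℤ × ℤ) :
    law q ρ (freshLink v K M y) ≤ ((2 * M + 1) * (M + 1) : ℕ) *
      ENNReal.ofReal (C * Real.exp (-(v * ((1 - v) * K) / 2))) := by
  rw [← card_box, ← nsmul_eq_mul]
  refine (measure_biUnion_finset_le _ _).trans (Finset.sum_le_card_nsmul _ _ _ fun a _ => ?_)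
  refine (law_void_compl_le ((measurableSet_link _ _ _).diff (measurableSet_meeting _))).trans
    ((measure_mono Set.sdiff_subset).trans ((hC _ _ (by simp)).trans_eq ?_))
  rw [level_add v (y + a), level_diag, add_sub_cancel_left]

theorem law_failedAt_inter_freshLink (hv : 0 < v) (hv1 : v ≤ 1) (p₀ p₁ : ℝ) (K M Δ j : ℕ)
    (y : ℤ × ℤ) :
    law q ρ (failedAt p₀ p₁ v K Δ j y ∩ freshLink v K M y) =
      law q ρ (failedAt p₀ p₁ v K Δ j y) * law q ρ (freshLink v K M y) := by
  have hindep := (Indep_iff _ _ (law q ρ)).1 (indep_observed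
    (disjoint_compl_right (a := meeting (backCone v y))) (Set.disjoint_empty (backCone v y)))
  refine hindep _ _ (measurableSet_observed_failedAt hv hv1 p₀ p₁ K Δ j y) ?_
  refine Finset.measurableSet_biUnion _ fun a _ => MeasurableSet.compl ?_
  exact measurableSet_observed_void ((measurableSet_link _ _ _).diff (measurableSet_meeting _))
    (fun w hw => hw.2)
    (measure_ne_top_of_subset Set.sdiff_subset (intensity_link hv (by simp)))

theorem law_failedAt_inter_freshLink_le (hv : 0 < v) (hv1 : v ≤ 1) (p₀ p₁ : ℝ) {K M : ℕ}
    (Δ j : ℕ) {κ : ℝ≥0∞} (hκ : ∀ y, law q ρ (freshLink v K M y) ≤ κ) :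
    law q ρ (⋃ y, failedAt p₀ p₁ v K Δ j y ∩ freshLink v K M y) ≤
      law q ρ (failed p₀ p₁ v K Δ j) * κ := by
  rw [failed, measure_iUnion (failedAt_pairwise_disjoint p₀ p₁ v K Δ j) fun y =>
    observed_le _ (measurableSet_observed_failedAt (q := q) (ρ := ρ) hv hv1 p₀ p₁ K Δ j y),
    ← ENNReal.tsum_mul_right]
  refine (measure_iUnion_le _).trans (ENNReal.tsum_le_tsum fun y => ?_)
  rw [law_failedAt_inter_freshLink hv hv1]
  gcongr
  exact hκ y

theorem law_failed_le (hv : 0 < v) (hv3 : v ≤ 1 / 3) {K L T M j : ℕ} {κ : ℝ≥0∞}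
    (hκ : ∀ y, law q ρ (freshLink v K M y) ≤ κ) (hL : 1 ≤ L)
    (hT : (L : ℝ) + (3 * L * (j + 1) : ℕ) ≤ 2 * v * T) (hM : 2 * (L : ℝ) ≤ v * M) :
    law q ρ (failed p₀ p₁ v K (3 * L) (j + 1)) ≤ law q ρ (unlinked p₀ p₁ v K (3 * L) (j + 1)) +
      (law q ρ (typical p₀ p₁ v L T)ᶜ + law q ρ (failed p₀ p₁ v K (3 * L) j) * κ) := by
  refine (measure_le_inter_add_sdiff _ _ (unlinked p₀ p₁ v K (3 * L) (j + 1))).trans ?_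
  refine add_le_add (measure_mono Set.inter_subset_right) ?_
  refine (measure_mono (failed_diff_unlinked_subset hv.le hv3 hL hT hM)).trans ?_
  refine (measure_union_le _ _).trans ?_
  gcongr
  exact law_failedAt_inter_freshLink_le hv (by linarith) p₀ p₁ (3 * L) j hκ

end Law

theorem le_pow_add_of_two_step {a : ℕ → ℝ} {σ κ e : ℝ} (hσ0 : 0 ≤ σ) (hσ1 : σ ≤ 1)
    (hκ : κ ≤ 1 / 4) (he : 0 ≤ e) (ha0 : ∀ j, 0 ≤ a j) (ha1 : ∀ j, a j ≤ 1) {J : ℕ}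
    (h : ∀ j < J, a (j + 2) ≤ a (j + 1) - σ * (a (j + 1) - κ * a j - e)) :
    a (J + 1) ≤ 2 * (1 - σ / 2) ^ (J + 1) + 2 * e := by
  set θ := 1 - σ / 2 with hθ
  have hθ0 : 0 ≤ θ := by linarith
  have hcontract : (1 - σ) * θ + σ / 4 ≤ θ * θ := by
    rw [hθ]
    nlinarith
  have hpair : ∀ j ≤ J, a j ≤ 2 * θ ^ j + 2 * e ∧ a (j + 1) ≤ 2 * θ ^ (j + 1) + 2 * e := by
    intro j
    induction j with
    | zero =>
      intro _
      rw [pow_zero, zero_add, pow_one]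
      constructor <;> linarith [ha1 0, ha1 1]
    | succ j ih =>
      intro hj
      obtain ⟨hprev, hlast⟩ := ih (by omega)
      refine ⟨hlast, (h j (by omega)).trans ?_⟩
      have hkeep : (1 - σ) * a (j + 1) ≤ (1 - σ) * (2 * θ ^ (j + 1) + 2 * e) :=
        mul_le_mul_of_nonneg_left hlast (sub_nonneg.2 hσ1)
      have hback : σ * (κ * a j) ≤ σ * (1 / 4 * (2 * θ ^ j + 2 * e)) :=
        mul_le_mul_of_nonneg_left (mul_le_mul hκ hprev (ha0 j) (by norm_num)) hσ0
      have hpow := mul_le_mul_of_nonneg_left hcontract (pow_nonneg hθ0 j)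
      have herror : 0 ≤ σ * e := mul_nonneg hσ0 he
      rw [pow_succ] at hkeep
      rw [pow_succ, pow_succ]
      linarith
  exact (hpair J le_rfl).2

theorem one_sub_pow_le_exp {x : ℝ} (hx : x ≤ 1) (n : ℕ) : (1 - x) ^ n ≤ Real.exp (-(x * n)) := by
  have hexp : 1 - x ≤ Real.exp (-x) := by linarith [Real.add_one_le_exp (-x)]
  refine (pow_le_pow_left₀ (sub_nonneg.2 hx) hexp n).trans_eq ?_
  rw [← Real.exp_nat_mul]
  ring_nf

section Tail

variable {q : ℝ} [IsProbabilityMeasure (lazyStep q)] {ρ : ℝ≥0} {p₀ p₁ v : ℝ}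

theorem real_law_failed_le (hv : 0 < v) (hv3 : v ≤ 1 / 3) {K L T M J : ℕ} {κ : ℝ≥0∞}
    (hκ : ∀ y, law q ρ (freshLink v K M y) ≤ κ) (hκ4 : κ ≤ ENNReal.ofReal (1 / 4))
    (hKL : K + 1 ≤ L) (hT : (L : ℝ) + (3 * L * (J + 1) : ℕ) ≤ 2 * v * T)
    (hM : 2 * (L : ℝ) ≤ v * M) :
    (law q ρ).real (failed p₀ p₁ v K (3 * L) (J + 1)) ≤ 2 *
        (1 - (forceProb p₀ p₁ ^ K * law q ρ (regen p₀ p₁ v 0)).toReal / 2) ^ (J + 1) +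
      2 * (law q ρ).real (typical p₀ p₁ v L T)ᶜ := by
  set σ : ℝ≥0∞ := forceProb p₀ p₁ ^ K * law q ρ (regen p₀ p₁ v 0)
  have hσ1 : σ ≤ 1 := mul_le_one' (pow_le_one' prob_le_one K) prob_le_one
  have hσ : σ ≠ ∞ := ne_top_of_le_ne_top ENNReal.one_ne_top hσ1
  have hκtop : κ ≠ ∞ := ne_top_of_le_ne_top ENNReal.ofReal_ne_top hκ4
  refine le_pow_add_of_two_step (a := fun j => (law q ρ).real (failed p₀ p₁ v K (3 * L) j))
    (κ := κ.toReal) ENNReal.toReal_nonneg (ENNReal.toReal_mono ENNReal.one_ne_top hσ1)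
    (ENNReal.toReal_le_of_le_ofReal (by norm_num) hκ4) measureReal_nonneg
    (fun _ => measureReal_nonneg) (fun _ => measureReal_le_one) fun j hj => ?_
  have hTj : (L : ℝ) + (3 * L * (j + 1) : ℕ) ≤ 2 * v * T := by
    have hjJ : 3 * L * (j + 1) ≤ 3 * L * (J + 1) := Nat.mul_le_mul_left _ (by omega)
    refine hT.trans' ?_
    gcongr
  have hsucceed := ENNReal.toReal_mono (measure_ne_top _ _) (law_failed_succ_le (q := q) (ρ := ρ)
    hv (by linarith) p₀ p₁ (K := K) (Δ := 3 * L) (by omega) (j + 1))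
  have hrefresh := ENNReal.toReal_mono (by finiteness) (law_failed_le (q := q) (ρ := ρ)
    (p₀ := p₀) (p₁ := p₁) hv hv3 hκ (by omega) hTj hM)
  rw [ENNReal.toReal_add (by finiteness) (by finiteness), ENNReal.toReal_mul] at hsucceed
  rw [ENNReal.toReal_add (by finiteness) (by finiteness),
    ENNReal.toReal_add (by finiteness) (by finiteness), ENNReal.toReal_mul] at hrefresh
  have hscaled := mul_le_mul_of_nonneg_right hrefresh (ENNReal.toReal_nonneg (a := σ))
  simp only [measureReal_def]
  linarith

theorem law_regenerationTime_gt_le (hv : 0 < v) (hv3 : v ≤ 1 / 3) {K L T M J : ℕ} {κ : ℝ≥0∞}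
    (hκ : ∀ y, law q ρ (freshLink v K M y) ≤ κ) (hκ4 : κ ≤ ENNReal.ofReal (1 / 4)) (hK : 1 ≤ K)
    (hKL : K + 1 ≤ L) (hT : (L : ℝ) + (3 * L * (J + 1) : ℕ) ≤ 2 * v * T)
    (hM : 2 * (L : ℝ) ≤ v * M) :
    law q ρ {s | (T : ℕ∞) < regenerationTime p₀ p₁ v s} ≤
      3 * law q ρ (typical p₀ p₁ v L T)ᶜ + ENNReal.ofReal (2 * Real.exp
        (-((forceProb p₀ p₁ ^ K * law q ρ (regen p₀ p₁ v 0)).toReal / 2 * (J + 1)))) := by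
  set σ : ℝ≥0∞ := forceProb p₀ p₁ ^ K * law q ρ (regen p₀ p₁ v 0)
  have hσ1 : σ ≤ 1 := mul_le_one' (pow_le_one' prob_le_one K) prob_le_one
  have hpow : (1 - σ.toReal / 2) ^ (J + 1) ≤ Real.exp (-(σ.toReal / 2 * (J + 1))) := by
    have hσ2 : σ.toReal / 2 ≤ 1 := by
      linarith [ENNReal.toReal_mono ENNReal.one_ne_top hσ1, ENNReal.toReal_one]
    exact_mod_cast one_sub_pow_le_exp hσ2 (J + 1)
  have hfailed : law q ρ (failed p₀ p₁ v K (3 * L) (J + 1)) ≤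
      2 * law q ρ (typical p₀ p₁ v L T)ᶜ +
        ENNReal.ofReal (2 * Real.exp (-(σ.toReal / 2 * (J + 1)))) := by
    rw [← ofReal_measureReal, ← ofReal_measureReal, ← ENNReal.ofReal_ofNat 2,
      ← ENNReal.ofReal_mul (by norm_num), ← ENNReal.ofReal_add (by positivity) (by positivity)]
    refine ENNReal.ofReal_le_ofReal ((real_law_failed_le hv hv3 hκ hκ4 hKL hT hM).trans ?_)
    linarith
  calc law q ρ {s | (T : ℕ∞) < regenerationTime p₀ p₁ v s}
      ≤ law q ρ (typical p₀ p₁ v L T)ᶜ + law q ρ (failed p₀ p₁ v K (3 * L) (J + 1)) :=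
        (measure_mono (regenerationTime_gt_subset hv.le hv3 hK hKL hT)).trans (measure_union_le _ _)
    _ ≤ law q ρ (typical p₀ p₁ v L T)ᶜ + (2 * law q ρ (typical p₀ p₁ v L T)ᶜ +
          ENNReal.ofReal (2 * Real.exp (-(σ.toReal / 2 * (J + 1))))) := by gcongr
    _ = _ := by ring

theorem typical_compl_subset (p₀ p₁ v : ℝ) (L T : ℕ) :
    (typical p₀ p₁ v L T)ᶜ ⊆ (⋃ z ∈ box T, lagging p₀ p₁ (3 * v) L z) ∪
      ⋃ y ∈ box T, ⋃ z ∈ box T,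
        {s | (y.2 ≤ z.2 ∧ (L : ℝ) ≤ level v z - level v y) ∧ s ∉ void (link v y z)} := by
  intro s hs
  simp only [typical, Set.mem_compl_iff, Set.mem_ofPred_eq, not_and_or] at hs
  push Not at hs
  rcases hs with ⟨z, hz, hlag⟩ | ⟨y, hy, z, hz, htime, hlevel, hlink⟩
  · exact Or.inl (Set.mem_biUnion hz hlag)
  · exact Or.inr (Set.mem_biUnion hy (Set.mem_biUnion hz ⟨⟨htime, hlevel⟩, hlink⟩))

theorem law_typical_compl_le {C c₀ γ : ℝ} (hv : 0 ≤ v) (hC0 : 0 ≤ C)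
    (hC : ∀ y z : ℤ × ℤ, y.2 ≤ z.2 → intensity q ρ (link v y z) ≤
      ENNReal.ofReal (C * Real.exp (-(v * (level v z - level v y) / 2))))
    (hball : BallisticityBound p₀ p₁ q ρ (3 * v) c₀ γ) {L : ℕ} (hL : 1 ≤ L) (T : ℕ) :
    law q ρ (typical p₀ p₁ v L T)ᶜ ≤
      ((2 * T + 1) * (T + 1) : ℕ) * ENNReal.ofReal (c₀⁻¹ * Real.exp (-c₀ * Real.log L ^ γ)) +
      ((2 * T + 1) * (T + 1) : ℕ) * (((2 * T + 1) * (T + 1) : ℕ) *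
        ENNReal.ofReal (C * Real.exp (-(v * L / 2)))) := by
  have hlink (y z : ℤ × ℤ) : law q ρ {s | (y.2 ≤ z.2 ∧ (L : ℝ) ≤ level v z - level v y) ∧
      s ∉ void (link v y z)} ≤ ENNReal.ofReal (C * Real.exp (-(v * L / 2))) := by
    by_cases h : y.2 ≤ z.2 ∧ (L : ℝ) ≤ level v z - level v y
    · simp only [h, true_and]
      refine (law_void_compl_le (measurableSet_link _ _ _)).trans ((hC y z h.1).trans ?_)
      have hlevel := h.2
      gcongr
    · simp [h]
  refine (measure_mono (typical_compl_subset p₀ p₁ v L T)).trans ((measure_union_le _ _).trans ?_)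
  rw [← card_box, ← nsmul_eq_mul, ← nsmul_eq_mul, ← nsmul_eq_mul]
  refine add_le_add ?_ ?_ <;>
    refine (measure_biUnion_finset_le _ _).trans (Finset.sum_le_card_nsmul _ _ _ fun y _ => ?_)
  · exact law_lagging_le hball hL y
  · exact (measure_biUnion_finset_le _ _).trans
      (Finset.sum_le_card_nsmul _ _ _ fun z _ => hlink y z)

end Tail

theorem eventually_mul_pow_le_exp_log_rpow (A : ℝ) (m : ℕ) {ε γ : ℝ} (hε : 0 < ε) (hγ : 1 < γ) :
    ∀ᶠ L : ℕ in atTop, A * (L : ℝ) ^ m ≤ Real.exp (ε * Real.log L ^ γ) := by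
  have hlog : Tendsto (fun L : ℕ => Real.log L) atTop atTop :=
    Real.tendsto_log_atTop.comp tendsto_natCast_atTop_atTop
  filter_upwards [((tendsto_rpow_atTop (sub_pos.2 hγ)).comp hlog).eventually_ge_atTop
    ((m + |A|) / ε), hlog.eventually_ge_atTop 1, eventually_ge_atTop 1] with L hpow hlog1 hL1
  have hL : (0 : ℝ) < L := by exact_mod_cast hL1
  rw [Function.comp_apply, div_le_iff₀' hε] at hpow
  set x := Real.log L with hx
  have hexponent : m * x + |A| ≤ ε * x ^ γ := by
    calc m * x + |A| ≤ (m + |A|) * x := by nlinarith [abs_nonneg A]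
      _ ≤ ε * x ^ (γ - 1) * x := by gcongr
      _ = ε * x ^ γ := by
        rw [mul_assoc, Real.rpow_sub_one (by linarith), div_mul_cancel₀ _ (by linarith)]
  calc A * (L : ℝ) ^ m = A * Real.exp (m * x) := by rw [hx, Real.exp_nat_mul, Real.exp_log hL]
    _ ≤ Real.exp |A| * Real.exp (m * x) := by
      gcongr
      linarith [le_abs_self A, Real.add_one_le_exp |A|]
    _ = Real.exp (m * x + |A|) := by rw [← Real.exp_add, add_comm]
    _ ≤ Real.exp (ε * x ^ γ) := Real.exp_le_exp.2 hexponent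

theorem eventually_mul_log_rpow_le (D : ℝ) {ε : ℝ} (γ : ℝ) (hε : 0 < ε) :
    ∀ᶠ L : ℕ in atTop, D * Real.log L ^ γ ≤ ε * L := by
  have hlittle := ((isLittleO_log_rpow_rpow_atTop γ one_pos).const_mul_left D).comp_tendsto
    tendsto_natCast_atTop_atTop
  filter_upwards [hlittle.def hε] with L hL
  simp only [Function.comp_apply, Real.rpow_one, Real.norm_eq_abs, Nat.abs_cast] at hL
  exact (le_abs_self _).trans hL

theorem eventually_mul_pow_mul_exp_neg_log_rpow_le (A : ℝ) (m : ℕ) {c γ : ℝ} (hc : 0 < c)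
    (hγ : 1 < γ) : ∀ᶠ L : ℕ in atTop,
      A * (L : ℝ) ^ m * Real.exp (-(c * Real.log L ^ γ)) ≤
        Real.exp (-(c / 2 * Real.log L ^ γ)) := by
  filter_upwards [eventually_mul_pow_le_exp_log_rpow A m (half_pos hc) hγ] with L hL
  calc A * (L : ℝ) ^ m * Real.exp (-(c * Real.log L ^ γ))
      ≤ Real.exp (c / 2 * Real.log L ^ γ) * Real.exp (-(c * Real.log L ^ γ)) := by gcongr
    _ = Real.exp (-(c / 2 * Real.log L ^ γ)) := by
      rw [← Real.exp_add]
      ring_nf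

theorem eventually_mul_pow_mul_exp_neg_le {A : ℝ} (hA : 0 ≤ A) (m : ℕ) {ε c γ : ℝ} (hε : 0 < ε)
    (hc : 0 < c) (hγ : 1 < γ) : ∀ᶠ L : ℕ in atTop,
      A * (L : ℝ) ^ m * Real.exp (-(ε * L)) ≤ Real.exp (-(c / 2 * Real.log L ^ γ)) := by
  filter_upwards [eventually_mul_log_rpow_le c γ hε,
    eventually_mul_pow_mul_exp_neg_log_rpow_le A m hc hγ] with L hlog hL
  refine le_trans ?_ hL
  gcongr

section ExpLogPow

variable {c γ : ℝ}

theorem expLogPow_natCast_mono (hc : 0 ≤ c) (hγ : 0 ≤ γ) {m n : ℕ} (h : m ≤ n) :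
    expLogPow c γ m ≤ expLogPow c γ n := by
  have hlog : Real.log m ≤ Real.log n := by
    rcases Nat.eq_zero_or_pos m with rfl | hm
    · simpa using Real.log_natCast_nonneg n
    · gcongr
  exact ENNReal.ofReal_le_ofReal (by gcongr)

theorem one_le_expLogPow (hc : 0 ≤ c) (n : ℕ) : 1 ≤ expLogPow c γ n :=
  ENNReal.one_le_ofReal.2
    (Real.one_le_exp (mul_nonneg hc (Real.rpow_nonneg (Real.log_natCast_nonneg n) _)))

theorem exists_pow_lt_le_pow {a : ℕ} (ha : a ≠ 0) {L₀ n : ℕ} (h : L₀ ^ a < n) :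
    ∃ k, (L₀ + k) ^ a < n ∧ n ≤ (L₀ + k + 1) ^ a := by
  classical
  have hex : ∃ k, n ≤ (L₀ + k + 1) ^ a :=
    ⟨n, (by omega : n ≤ L₀ + n + 1).trans (Nat.le_self_pow ha _)⟩
  refine ⟨Nat.find hex, ?_, Nat.find_spec hex⟩
  cases hfind : Nat.find hex with
  | zero => exact h
  | succ k => exact not_le.1 (Nat.find_min hex (by omega))

open Classical in
theorem expLogPow_le_tsum (hc : 0 ≤ c) (hγ : 0 ≤ γ) {a : ℕ} (ha : a ≠ 0) (L₀ : ℕ)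
    (t : ℕ∞) : expLogPow c γ t ≤ expLogPow c γ ((L₀ ^ a : ℕ) : ℕ∞) +
      ∑' k : ℕ, if (((L₀ + k) ^ a : ℕ) : ℕ∞) < t then
        expLogPow c γ (((L₀ + k + 1) ^ a : ℕ) : ℕ∞) else 0 := by
  induction t using ENat.recTopCoe with
  | top =>
    refine le_top.trans (le_trans ?_ le_add_self)
    rw [← ENNReal.tsum_const_eq_top_of_ne_zero (α := ℕ) one_ne_zero]
    refine ENNReal.tsum_le_tsum fun k => ?_
    rw [if_pos (ENat.natCast_lt_top _)]
    exact one_le_expLogPow hc _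
  | coe n =>
    rcases le_or_gt n (L₀ ^ a) with h | h
    · exact (expLogPow_natCast_mono hc hγ h).trans le_self_add
    · obtain ⟨k, hlt, hle⟩ := exists_pow_lt_le_pow ha h
      refine le_trans ?_ ((ENNReal.le_tsum k).trans le_add_self)
      rw [if_pos (by exact_mod_cast hlt)]
      exact expLogPow_natCast_mono hc hγ hle

theorem lintegral_expLogPow_le_tsum {Ω : Type*} [MeasurableSpace Ω] {μ : Measure Ω}
    [IsProbabilityMeasure μ] (τ : Ω → ℕ∞) (hc : 0 ≤ c) (hγ : 0 ≤ γ) {a : ℕ} (ha : a ≠ 0)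
    (L₀ : ℕ) : ∫⁻ ω, expLogPow c γ (τ ω) ∂μ ≤ expLogPow c γ ((L₀ ^ a : ℕ) : ℕ∞) +
      ∑' k : ℕ, expLogPow c γ (((L₀ + k + 1) ^ a : ℕ) : ℕ∞) *
        μ {ω | (((L₀ + k) ^ a : ℕ) : ℕ∞) < τ ω} := by
  classical
  set A : ℕ → Set Ω := fun k => toMeasurable μ {ω | (((L₀ + k) ^ a : ℕ) : ℕ∞) < τ ω}
  have hA (k : ℕ) : MeasurableSet (A k) := measurableSet_toMeasurable _ _
  calc ∫⁻ ω, expLogPow c γ (τ ω) ∂μ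
      ≤ ∫⁻ ω, expLogPow c γ ((L₀ ^ a : ℕ) : ℕ∞) + ∑' k : ℕ, (A k).indicator
          (fun _ => expLogPow c γ (((L₀ + k + 1) ^ a : ℕ) : ℕ∞)) ω ∂μ := by
        refine lintegral_mono fun ω => (expLogPow_le_tsum hc hγ ha L₀ (τ ω)).trans ?_
        gcongr with k
        split_ifs with hk
        · rw [Set.indicator_of_mem (subset_toMeasurable μ _ hk)]
        · exact zero_le
    _ = _ := by
        rw [lintegral_add_left measurable_const, lintegral_const, measure_univ, mul_one,
          lintegral_tsum fun k => (measurable_const.indicator (hA k)).aemeasurable]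
        simp only [lintegral_indicator_const (hA _), A, measure_toMeasurable]

theorem log_succ_pow_le (a : ℕ) {L : ℕ} (hL : 2 ≤ L) :
    Real.log ((L + 1) ^ a : ℕ) ≤ 2 * a * Real.log L := by
  have hsucc : L + 1 ≤ L ^ 2 := by nlinarith
  calc Real.log ((L + 1) ^ a : ℕ) ≤ Real.log ((L ^ 2) ^ a : ℕ) := by gcongr
    _ = 2 * a * Real.log L := by
      rw [← pow_mul, Nat.cast_pow, Real.log_pow]
      push_cast
      ring

theorem expLogPow_mul_exp_neg_le {δ : ℝ} (hδ : 0 ≤ δ) (hγ : 0 ≤ γ) {a : ℕ} (ha : a ≠ 0) {L : ℕ}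
    (hL : 2 ≤ L) : expLogPow (δ / (2 * (2 * a) ^ γ)) γ (((L + 1) ^ a : ℕ) : ℕ∞) *
      ENNReal.ofReal (Real.exp (-(δ * Real.log L ^ γ))) ≤
        ENNReal.ofReal (Real.exp (-(δ / 2 * Real.log L ^ γ))) := by
  have hlog0 := Real.log_natCast_nonneg L
  have hpow : δ / (2 * (2 * a) ^ γ) * Real.log ((L + 1) ^ a : ℕ) ^ γ ≤
      δ / 2 * Real.log L ^ γ := by
    calc δ / (2 * (2 * a) ^ γ) * Real.log ((L + 1) ^ a : ℕ) ^ γ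
        ≤ δ / (2 * (2 * a) ^ γ) * (2 * a * Real.log L) ^ γ := by
          gcongr
          exact log_succ_pow_le a hL
      _ = δ / 2 * Real.log L ^ γ := by
          rw [Real.mul_rpow (by positivity) hlog0]
          field_simp
  change ENNReal.ofReal _ * _ ≤ _
  rw [← ENNReal.ofReal_mul (by positivity), ← Real.exp_add]
  exact ENNReal.ofReal_le_ofReal (Real.exp_le_exp.2 (by linarith))

theorem exists_lintegral_expLogPow_lt_top {Ω : Type*} [MeasurableSpace Ω] {μ : Measure Ω}
    [IsProbabilityMeasure μ] {τ : Ω → ℕ∞} {δ : ℝ} (hδ : 0 < δ) (hγ : 1 < γ) {a : ℕ} (ha : a ≠ 0)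
    (htail : ∀ᶠ L : ℕ in atTop, μ {ω | ((L ^ a : ℕ) : ℕ∞) < τ ω} ≤
      ENNReal.ofReal (Real.exp (-(δ * Real.log L ^ γ)))) :
    ∃ c : ℝ, 0 < c ∧ ∫⁻ ω, expLogPow c γ (τ ω) ∂μ < ⊤ := by
  have hc : 0 < δ / (2 * (2 * a) ^ γ) := by positivity
  have hγ0 : 0 ≤ γ := by linarith
  obtain ⟨L₀, hL₀⟩ := eventually_atTop.1 (htail.and
    ((eventually_mul_pow_le_exp_log_rpow 1 2 (half_pos hδ) hγ).and (eventually_ge_atTop 2)))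
  refine ⟨_, hc, (lintegral_expLogPow_le_tsum τ hc.le hγ0 ha L₀).trans_lt
    (ENNReal.add_lt_top.2 ⟨ENNReal.ofReal_lt_top, ?_⟩)⟩
  have hsummable : Summable fun k : ℕ => (((k + L₀ : ℕ) : ℝ) ^ 2)⁻¹ :=
    (summable_nat_add_iff L₀).2 (Real.summable_nat_pow_inv.2 one_lt_two)
  refine lt_of_le_of_lt (ENNReal.tsum_le_tsum fun k => ?_) hsummable.tsum_ofReal_lt_top
  obtain ⟨htailk, hsq, hk2⟩ := hL₀ (k + L₀) (by omega)
  rw [add_comm L₀ k]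
  refine (mul_le_mul_right htailk _).trans ((expLogPow_mul_exp_neg_le hδ.le hγ0 ha hk2).trans ?_)
  rw [Real.exp_neg]
  refine ENNReal.ofReal_le_ofReal (inv_anti₀ (by positivity) ?_)
  rwa [one_mul] at hsq

end ExpLogPow

/-- The number of forced steps in a trial at scale `L`. It is large enough for fresh links to be
unlikely, and small enough for the forcing to have a probability that is polynomial in `L`. -/
noncomputable def forcedLength (v : ℝ) (L : ℕ) : ℕ := ⌈15 / v * Real.log L⌉₊ + 1

section Scale

variable {v : ℝ}

theorem log_le_forcedLength (hv : 0 < v) (L : ℕ) : 15 * Real.log L ≤ v * forcedLength v L := by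
  have hceil := mul_le_mul_of_nonneg_left (Nat.le_ceil (15 / v * Real.log L)) hv.le
  rw [← mul_assoc, mul_div_cancel₀ _ hv.ne'] at hceil
  rw [forcedLength]
  push_cast
  linarith

theorem forcedLength_le (hv : 0 < v) (L : ℕ) :
    (forcedLength v L : ℝ) ≤ 15 / v * Real.log L + 2 := by
  have hceil : (⌈15 / v * Real.log L⌉₊ : ℝ) < 15 / v * Real.log L + 1 :=
    Nat.ceil_lt_add_one (mul_nonneg (by positivity) (Real.log_natCast_nonneg L))
  rw [forcedLength]
  push_cast
  linarith

theorem eventually_forcedLength_lt (hv : 0 < v) : ∀ᶠ L : ℕ in atTop, forcedLength v L + 1 ≤ L := by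
  filter_upwards [eventually_mul_log_rpow_le (15 / v) 1 one_half_pos,
    eventually_ge_atTop 6] with L hlog hL
  have hL6 : (6 : ℝ) ≤ L := by exact_mod_cast hL
  rw [Real.rpow_one] at hlog
  have hle : (forcedLength v L : ℝ) + 1 ≤ L := by linarith [forcedLength_le hv L]
  exact_mod_cast hle

theorem sq_le_pow_forcedLength_mul_pow (hv : 0 < v) {p : ℝ} (hp : 0 < p) (hp1 : p ≤ 1) {L : ℕ}
    (hL : 1 ≤ L) : p ^ 2 ≤ p ^ forcedLength v L * (L : ℝ) ^ ⌈15 / v * -Real.log p⌉₊ := by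
  have hLpos : (0 : ℝ) < L := by exact_mod_cast hL
  have hpow {x : ℝ} (hx : 0 < x) (n : ℕ) : x ^ n = Real.exp (n * Real.log x) := by
    rw [Real.exp_nat_mul, Real.exp_log hx]
  have hforced := mul_le_mul_of_nonneg_right (forcedLength_le hv L)
    (neg_nonneg.2 (Real.log_nonpos hp.le hp1))
  have hceil := mul_le_mul_of_nonneg_right (Nat.le_ceil (15 / v * -Real.log p))
    (Real.log_natCast_nonneg L)
  rw [hpow hp, hpow hp, hpow hLpos, ← Real.exp_add, Real.exp_le_exp]
  push_cast
  linarith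

theorem box_size_le {n : ℕ} (hn : 1 ≤ n) :
    (((2 * n + 1) * (n + 1) : ℕ) : ℝ) ≤ 6 * (n : ℝ) ^ 2 := by
  have hn1 : (1 : ℝ) ≤ n := by exact_mod_cast hn
  push_cast
  nlinarith

theorem eventually_add_le_two_mul_pow (hv : 0 < v) (b : ℕ) : ∀ᶠ L : ℕ in atTop,
    (L : ℝ) + (3 * L * (L ^ (b + 1) + 1) : ℕ) ≤ 2 * v * (L ^ (b + 3) : ℕ) := by
  filter_upwards [tendsto_natCast_atTop_atTop.eventually_ge_atTop (7 / (2 * v)),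
    eventually_ge_atTop 1] with L hv7 hL
  have hL1 : (1 : ℝ) ≤ L := by exact_mod_cast hL
  rw [div_le_iff₀' (by positivity)] at hv7
  have hone : (1 : ℝ) ≤ L ^ (b + 1) := one_le_pow₀ hL1
  calc (L : ℝ) + (3 * L * (L ^ (b + 1) + 1) : ℕ) = 4 * (L * 1) + 3 * (L * L ^ (b + 1)) := by
        push_cast
        ring
    _ ≤ 4 * (L * L ^ (b + 1)) + 3 * (L * L ^ (b + 1)) := by gcongr
    _ = 7 * (L * L ^ (b + 1)) := by ring
    _ ≤ 2 * v * L * (L * L ^ (b + 1)) := by gcongr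
    _ = 2 * v * (L ^ (b + 3) : ℕ) := by
        push_cast
        ring

theorem eventually_two_mul_le_mul_sq (hv : 0 < v) :
    ∀ᶠ L : ℕ in atTop, 2 * (L : ℝ) ≤ v * (L ^ 2 : ℕ) := by
  filter_upwards [tendsto_natCast_atTop_atTop.eventually_ge_atTop (2 / v)] with L hL
  rw [div_le_iff₀' hv] at hL
  push_cast
  nlinarith [Nat.cast_nonneg (α := ℝ) L]

end Scale

section Law

variable {q : ℝ} [IsProbabilityMeasure (lazyStep q)] {ρ : ℝ≥0} {p₀ p₁ v : ℝ}

theorem eventually_law_freshLink_le (hv : 0 < v) (hv3 : v ≤ 1 / 3) : ∀ᶠ L : ℕ in atTop,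
    ∀ y, law q ρ (freshLink v (forcedLength v L) (L ^ 2) y) ≤ ENNReal.ofReal (1 / 4) := by
  obtain ⟨C, hC, hlink⟩ := exists_intensity_link_le (q := q) (ρ := ρ) hv
  filter_upwards [tendsto_natCast_atTop_atTop.eventually_ge_atTop (24 * C),
    eventually_ge_atTop 1] with L hLC hL y
  have hLpos : (0 : ℝ) < L := by exact_mod_cast hL
  set K := forcedLength v L
  have hexponent : 5 * Real.log L ≤ v * ((1 - v) * K) / 2 := by
    have hvK := mul_le_mul_of_nonneg_right hv3 (by positivity : (0 : ℝ) ≤ v * K)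
    linarith [log_le_forcedLength hv L]
  have hexp : Real.exp (-(v * ((1 - v) * K) / 2)) ≤ ((L : ℝ) ^ 5)⁻¹ := by
    calc Real.exp (-(v * ((1 - v) * K) / 2)) ≤ Real.exp (-((5 : ℕ) * Real.log L)) :=
          Real.exp_le_exp.2 (neg_le_neg (by exact_mod_cast hexponent))
      _ = ((L : ℝ) ^ 5)⁻¹ := by rw [Real.exp_neg, Real.exp_nat_mul, Real.exp_log hLpos]
  refine (law_freshLink_le hlink K (L ^ 2) y).trans ?_
  rw [← ENNReal.ofReal_natCast, ← ENNReal.ofReal_mul (by positivity)]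
  refine ENNReal.ofReal_le_ofReal ?_
  calc (((2 * L ^ 2 + 1) * (L ^ 2 + 1) : ℕ) : ℝ) * (C * Real.exp (-(v * ((1 - v) * K) / 2)))
      ≤ 6 * ((L ^ 2 : ℕ) : ℝ) ^ 2 * (C * ((L : ℝ) ^ 5)⁻¹) := by
        gcongr
        exact box_size_le (Nat.one_le_pow _ _ hL)
    _ = 6 * C / L := by
        push_cast
        field_simp
    _ ≤ 1 / 4 := by
        rw [div_le_iff₀ hLpos]
        linarith

theorem eventually_law_typical_compl_le {c₀ γ : ℝ} (hv : 0 < v) (hc₀ : 0 < c₀) (hγ : 1 < γ)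
    (hball : BallisticityBound p₀ p₁ q ρ (3 * v) c₀ γ) (a : ℕ) : ∀ᶠ L : ℕ in atTop,
      law q ρ (typical p₀ p₁ v L (L ^ a))ᶜ ≤
        ENNReal.ofReal (1 / 6 * Real.exp (-(c₀ / 2 * Real.log L ^ γ))) := by
  obtain ⟨C, hC, hlink⟩ := exists_intensity_link_le (q := q) (ρ := ρ) hv
  filter_upwards [eventually_ge_atTop 1,
    eventually_mul_pow_mul_exp_neg_log_rpow_le (72 * c₀⁻¹) (2 * a) hc₀ hγ,
    eventually_mul_pow_mul_exp_neg_le (by positivity : 0 ≤ 432 * C) (4 * a) (half_pos hv) hc₀ hγ]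
    with L hL hlagging hlinked
  refine (law_typical_compl_le hv.le hC.le hlink hball hL (L ^ a)).trans ?_
  set n : ℕ := (2 * L ^ a + 1) * (L ^ a + 1)
  have hbox : (n : ℝ) ≤ 6 * (L : ℝ) ^ (2 * a) := by
    refine (box_size_le (Nat.one_le_pow _ _ hL)).trans_eq ?_
    rw [Nat.cast_pow, ← pow_mul, mul_comm a 2]
  rw [← ENNReal.ofReal_natCast n, ← ENNReal.ofReal_mul (by positivity),
    ← ENNReal.ofReal_mul (by positivity), ← ENNReal.ofReal_mul (by positivity),
    ← ENNReal.ofReal_add (by positivity) (by positivity)]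
  refine ENNReal.ofReal_le_ofReal ?_
  calc (n : ℝ) * (c₀⁻¹ * Real.exp (-c₀ * Real.log L ^ γ)) +
        n * (n * (C * Real.exp (-(v * L / 2))))
      ≤ 6 * (L : ℝ) ^ (2 * a) * (c₀⁻¹ * Real.exp (-c₀ * Real.log L ^ γ)) +
        6 * (L : ℝ) ^ (2 * a) * (6 * (L : ℝ) ^ (2 * a) * (C * Real.exp (-(v * L / 2)))) := by
        gcongr
    _ = 1 / 12 * (72 * c₀⁻¹ * (L : ℝ) ^ (2 * a) * Real.exp (-(c₀ * Real.log L ^ γ))) +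
        1 / 12 * (432 * C * (L : ℝ) ^ (4 * a) * Real.exp (-(v / 2 * L))) := by ring_nf
    _ ≤ 1 / 6 * Real.exp (-(c₀ / 2 * Real.log L ^ γ)) := by linarith

theorem eventually_exp_neg_trials_le {p r c₀ γ : ℝ} (hv : 0 < v) (hp : 0 < p) (hp1 : p ≤ 1)
    (hr : 0 < r) (hc₀ : 0 < c₀) (hγ : 1 < γ) : ∀ᶠ L : ℕ in atTop,
      2 * Real.exp (-(p ^ forcedLength v L * r / 2 *
        ((L ^ (⌈15 / v * -Real.log p⌉₊ + 1) : ℕ) + 1))) ≤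
        1 / 2 * Real.exp (-(c₀ / 2 * Real.log L ^ γ)) := by
  filter_upwards [eventually_mul_pow_mul_exp_neg_le (by norm_num : (0 : ℝ) ≤ 4) 0
    (by positivity : 0 < p ^ 2 * r / 2) hc₀ hγ, eventually_ge_atTop 1] with L hL hL1
  set K := forcedLength v L
  set b := ⌈15 / v * -Real.log p⌉₊
  have hexponent : p ^ 2 * r / 2 * L ≤ p ^ K * r / 2 * ((L ^ (b + 1) : ℕ) + 1) := by
    calc p ^ 2 * r / 2 * L ≤ p ^ K * (L : ℝ) ^ b * r / 2 * L := by
          gcongr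
          exact sq_le_pow_forcedLength_mul_pow hv hp hp1 hL1
      _ = p ^ K * r / 2 * (L ^ (b + 1) : ℕ) := by
          push_cast
          ring
      _ ≤ p ^ K * r / 2 * ((L ^ (b + 1) : ℕ) + 1) := by
          gcongr
          exact le_add_of_nonneg_right zero_le_one
  linarith [Real.exp_le_exp.2 (neg_le_neg hexponent)]

theorem exists_law_regenerationTime_gt_le {c₀ γ : ℝ} (hp : forceProb p₀ p₁ ≠ 0) (hv : 0 < v)
    (hv3 : v ≤ 1 / 3) (hc₀ : 0 < c₀) (hγ : 1 < γ)
    (hball : BallisticityBound p₀ p₁ q ρ (3 * v) c₀ γ) :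
    ∃ a : ℕ, a ≠ 0 ∧ ∀ᶠ L : ℕ in atTop,
      law q ρ {s | ((L ^ a : ℕ) : ℕ∞) < regenerationTime p₀ p₁ v s} ≤
        ENNReal.ofReal (Real.exp (-(c₀ / 2 * Real.log L ^ γ))) := by
  have hregen : law q ρ (regen p₀ p₁ v 0) ≠ 0 :=
    law_regen_ne_zero hp hv (by linarith) (by linarith) hc₀ (by linarith) hball 0
  have hp1 : (forceProb p₀ p₁).toReal ≤ 1 := ENNReal.toReal_mono ENNReal.one_ne_top prob_le_one
  set b := ⌈15 / v * -Real.log (forceProb p₀ p₁).toReal⌉₊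
  refine ⟨b + 3, by omega, ?_⟩
  filter_upwards [eventually_forcedLength_lt hv,
    eventually_law_freshLink_le (q := q) (ρ := ρ) hv hv3,
    eventually_add_le_two_mul_pow hv b, eventually_two_mul_le_mul_sq hv,
    eventually_law_typical_compl_le hv hc₀ hγ hball (b + 3),
    eventually_exp_neg_trials_le hv (ENNReal.toReal_pos hp (measure_ne_top _ _)) hp1
      (ENNReal.toReal_pos hregen (measure_ne_top _ _)) hc₀ hγ]
    with L hforced hfresh htime hbox htypical htrials
  set E := Real.exp (-(c₀ / 2 * Real.log L ^ γ))
  refine (law_regenerationTime_gt_le hv hv3 hfresh le_rfl (Nat.le_add_left 1 _) hforced htime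
    hbox).trans ?_
  rw [ENNReal.toReal_mul, ENNReal.toReal_pow]
  calc _ ≤ 3 * ENNReal.ofReal (1 / 6 * E) + ENNReal.ofReal (1 / 2 * E) := by gcongr
    _ = ENNReal.ofReal E := by
      rw [← ENNReal.ofReal_ofNat 3, ← ENNReal.ofReal_mul (by norm_num),
        ← ENNReal.ofReal_add (by positivity) (by positivity)]
      ring_nf

theorem le_one_of_ballisticityBound {vstar c₀ γ : ℝ} (hc₀ : 0 < c₀) (hγ : 0 < γ)
    (hball : BallisticityBound p₀ p₁ q ρ vstar c₀ γ) : vstar ≤ 1 := by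
  by_contra! hvstar
  have htail := ENNReal.tendsto_ofReal (tendsto_exp_neg_log_rpow hc₀ hγ)
  rw [ENNReal.ofReal_zero] at htail
  obtain ⟨L, hlt, hL⟩ := ((htail.eventually_lt_const one_pos).and (eventually_ge_atTop 1)).exists
  obtain ⟨n, hn⟩ := exists_nat_gt (L / (vstar - 1))
  rw [div_lt_iff₀ (sub_pos.2 hvstar)] at hn
  have hn1 : 1 ≤ n := by
    by_contra! hn0
    simp [Nat.lt_one_iff.1 hn0] at hn
    linarith
  have huniv : {s | ∃ n : ℕ, 1 ≤ n ∧ (X p₀ p₁ s n : ℝ) < n * vstar - L} = Set.univ := by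
    refine Set.eq_univ_of_forall fun s => ⟨n, hn1, ?_⟩
    have hX : (X p₀ p₁ s n : ℝ) ≤ n := by
      have hfst := (abs_le.1 (abs_walk_fst_sub_le (dir p₀ p₁ s) (0, 0) n)).2
      rw [X, Y_eq_walk]
      exact_mod_cast (sub_zero _).symm.trans_le hfst
    linarith
  refine hlt.not_ge (le_trans ?_ (hball L hL))
  rw [huniv, measure_univ]

end Law

section Law

variable {q : ℝ} {ρ : ℝ≥0} {p₀ p₁ v : ℝ}

theorem law_originRegenerates_ne_zero (hregen : law q ρ (regen p₀ p₁ v 0) ≠ 0) :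
    law q ρ (originRegenerates p₀ p₁ v) ≠ 0 :=
  ne_bot_of_le_ne_bot hregen (measure_mono fun _ => regenerates_of_mem_regen)

theorem lintegral_coneLaw_lt_top (horigin : law q ρ (originRegenerates p₀ p₁ v) ≠ 0)
    {f : Sample → ℝ≥0∞} (hf : ∫⁻ s, f s ∂law q ρ < ⊤) : ∫⁻ s, f s ∂coneLaw p₀ p₁ q ρ v < ⊤ := by
  rw [coneLaw, ProbabilityTheory.cond, lintegral_smul_measure, smul_eq_mul]
  exact ENNReal.mul_lt_top (ENNReal.inv_lt_top.2 (pos_iff_ne_zero.2 horigin))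
    ((lintegral_mono' Measure.restrict_le_self le_rfl).trans_lt hf)

end Law

end RWDRE

theorem theoremt_general
    (p₀ p₁ : ℝ) (hp₀ : 0 < p₀) (hp₁ : 0 < p₁) (q : ℝ) (hq : q ∈ Set.Icc (0 : ℝ) 1) (ρ : ℝ≥0)
    (vstar : ℝ) (hvstar : 0 < vstar) (c₀ γ : ℝ) (hc₀ : 0 < c₀) (hγ : 1 < γ)
    (hball : RWDRE.BallisticityBound p₀ p₁ q ρ vstar c₀ γ) :
    RWDRE.law q ρ (RWDRE.originRegenerates p₀ p₁ (vstar / 3)) ≠ 0 ∧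
    ∃ c : ℝ, 0 < c ∧
      ∫⁻ s, RWDRE.expLogPow c γ (RWDRE.regenerationTime p₀ p₁ (vstar / 3) s)
        ∂(RWDRE.law q ρ) < ⊤ ∧
      ∫⁻ s, RWDRE.expLogPow c γ (RWDRE.regenerationTime p₀ p₁ (vstar / 3) s)
        ∂(RWDRE.coneLaw p₀ p₁ q ρ (vstar / 3)) < ⊤ := by
  have := RWDRE.isProbabilityMeasure_lazyStep hq.1 hq.2
  have := RWDRE.isProbabilityMeasure_law hq.1 hq.2 ρ
  have hvstar1 := RWDRE.le_one_of_ballisticityBound hc₀ (by linarith) hball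
  have hforce := RWDRE.forceProb_ne_zero hp₀ hp₁
  have horigin := RWDRE.law_originRegenerates_ne_zero (RWDRE.law_regen_ne_zero (v := vstar / 3)
    hforce (by linarith) (by linarith) (by linarith) hc₀ (by linarith) hball 0)
  obtain ⟨a, ha, htail⟩ := RWDRE.exists_law_regenerationTime_gt_le (v := vstar / 3) hforce
    (by linarith) (by linarith) hc₀ hγ (by rwa [mul_div_cancel₀ _ three_ne_zero])
  obtain ⟨c, hc, hfin⟩ := RWDRE.exists_lintegral_expLogPow_lt_top (half_pos hc₀) hγ ha htail
  exact ⟨horigin, c, hc, hfin, RWDRE.lintegral_coneLaw_lt_top horigin hfin⟩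

theorem theoremt
    (p₀ p₁ : ℝ) (hp₀ : p₀ ∈ Set.Icc (0 : ℝ) 1) (hp₁ : p₁ ∈ Set.Icc (0 : ℝ) 1)
    (v₀ v₁ : ℝ) (hv₀ : v₀ = 2 * p₀ - 1) (hv₁ : v₁ = 2 * p₁ - 1) (hell : -1 < v₀)
    (q : ℝ) (hq : q ∈ Set.Ioo (0 : ℝ) 1) (ρ : ℝ≥0) (hρ : 0 < ρ)
    (vstar : ℝ) (hvstar : vstar ∈ Set.Ioo (0 : ℝ) v₁)
    (c₀ γ : ℝ) (hc₀ : 0 < c₀) (hγ : 1 < γ)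
    (hball : RWDRE.BallisticityBound p₀ p₁ q ρ vstar c₀ γ) :
    RWDRE.law q ρ (RWDRE.originRegenerates p₀ p₁ (vstar / 3)) ≠ 0 ∧
    ∃ c : ℝ, 0 < c ∧
      ∫⁻ s, RWDRE.expLogPow c γ (RWDRE.regenerationTime p₀ p₁ (vstar / 3) s)
        ∂(RWDRE.law q ρ) < ⊤ ∧
      ∫⁻ s, RWDRE.expLogPow c γ (RWDRE.regenerationTime p₀ p₁ (vstar / 3) s)
        ∂(RWDRE.coneLaw p₀ p₁ q ρ (vstar / 3)) < ⊤ := by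
  exact theoremt_general p₀ p₁ (by linarith) (by linarith [hvstar.1, hvstar.2]) q
    (Set.Ioo_subset_Icc_self hq) ρ vstar hvstar.1 c₀ γ hc₀ hγ hball
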